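/- Let $G$ be a finite group, $p$ a prime, and $P\in\mathrm{Syl}_p(G)$. Assume that $G$ is $p$-solvable (it has a series $1=N_0\le N_1\le\cdots\le N_n=G$ of normal subgroups of $G$ whose factors have order a power of $p$ or coprime to $p$) and that $\mathbf N_G(P)=P$. All characters are complex; $\mathrm{Irr}_{p'}(X)$ is the set of irreducible characters of $X$ of degree not divisible by $p$; $P^g=g^{-1}Pg$; and $\mathrm{Irr}(P/P')$, where $P'$ is the derived subgroup of $P$, is identified by inflation with the set of linear characters of $P$. A subgroup $Q\le P$ is *picky* if, for every $g\in G$, $Q\le P^g$ implies $P^g=P$. (1) For every $\chi\in\mathrm{Irr}_{p'}(G)$ one can choose a linear character $\lambda_\chi\in\mathrm{Irr}(P)$ and a character (or zero) $\Delta_\chi$ of $P$ such that $$\chi_P=\lambda_\chi+\Delta_\chi,$$ where $\Delta_\chi$ is a (possibly empty) sum of characters induced to $P$ from characters of non-picky subgroups of $P$, and such that the map $\chi\mapsto\lambda_\chi$ is a bijection from $\mathrm{Irr}_{p'}(G)$ onto $\mathrm{Irr}(P/P')$. (2) In particular, Evseev's condition (IRC-Syl) holds for $G$: with $H=\mathbf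 N_G(P)$, there is a bijection $F:\pm\mathrm{Irr}_{p'}(G)\to\pm\mathrm{Irr}_{p'}(H)$ with $F(-\chi)=-F(\chi)$ and $$F(\chi)-\chi_H\in I(H,P,S(G,P,H))\qquad\text{for every }\chi\in\pm\mathrm{Irr}_{p'}(G).$$ Here $S(G,P,H)=\{Q\le P\mid Q\le P^t\text{ for some }t\in G\setminus H\}$, and for a finite group $X\ge P$ and a set $S$ of subgroups of $P$, $I(X,P,S)$ is the additive group generated by all induced generalized characters $\theta^X$, where $\theta\in\mathbb Z\,\mathrm{Irr}(L)$ for some subgroup $L\le X$ with $L\cap P\in\mathrm{Syl}_p(L)$ and $L\cap P\in S$. -/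

import Mathlib

namespace EvseevPicky

/-- `f : X → ℂ` is the character of a finite-dimensional complex representation of `X`.
The zero representation is allowed, so "character" here means "character or zero". -/
def IsCharacterOrZero {X : Type*} [Group X] (f : X → ℂ) : Prop :=
  ∃ (n : ℕ) (ρ : Representation ℂ X (Fin n → ℂ)), f = ρ.character

/-- `Irr(X)`: the set of irreducible complex characters of `X`, as functions `X → ℂ`. -/
def Irr (X : Type*) [Group X] : Set (X → ℂ) :=
  {χ | ∃ (n : ℕ) (ρ : Representation ℂ X (Fin n → ℂ)), ρ.IsIrreducible ∧ χ = ρ.character}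

/-- `Irr_{p'}(X)`: the irreducible complex characters of degree not divisible by `p`. -/
def IrrPrime (p : ℕ) (X : Type*) [Group X] : Set (X → ℂ) :=
  {χ | χ ∈ Irr X ∧ ∃ d : ℕ, χ 1 = (d : ℂ) ∧ ¬ p ∣ d}

/-- `± Irr_{p'}(X)`. -/
def SignedIrrPrime (p : ℕ) (X : Type*) [Group X] : Set (X → ℂ) :=
  {f | f ∈ IrrPrime p X ∨ -f ∈ IrrPrime p X}

/-- `𝒞(X) = ℤ Irr(X)`: the group of generalized (virtual) characters of `X`. -/
def genChar (X : Type*) [Group X] : AddSubgroup (X → ℂ) :=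
  AddSubgroup.closure (Irr X)

/-- Restriction of a function on `X` to a subgroup. -/
def res {X : Type*} [Group X] (L : Subgroup X) (f : X → ℂ) : L → ℂ :=
  fun x => f (x : X)

open Classical in
/-- The induced function `θ^X` (for `X` finite):
`θ^X(x) = |L|⁻¹ ∑_{y ∈ X} θ°(y⁻¹ x y)`, where `θ°` is `θ` extended by zero outside `L`. -/
noncomputable def ind {X : Type*} [Group X] (L : Subgroup X) (θ : L → ℂ) : X → ℂ :=
  fun x => (Nat.card L : ℂ)⁻¹ *
    ∑ᶠ y : X, if h : y⁻¹ * x * y ∈ L then θ ⟨y⁻¹ * x * y, h⟩ else 0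

/-- The conjugate subgroup `P^g = g⁻¹ P g`. -/
def conjBy {X : Type*} [Group X] (P : Subgroup X) (g : X) : Subgroup X :=
  P.map (MulAut.conj g⁻¹).toMonoidHom

/-- A finite group `X` is `p`-solvable: it has a series `1 = N 0 ≤ N 1 ≤ ⋯ ≤ N n = X` of normal
subgroups of `X`, each factor of which has order a power of `p` or coprime to `p`. -/
def IsPSolvable (p : ℕ) (X : Type*) [Group X] : Prop :=
  ∃ (n : ℕ) (N : ℕ → Subgroup X), N 0 = ⊥ ∧ N n = ⊤ ∧ (∀ i, (N i).Normal) ∧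
    ∀ i < n, N i ≤ N (i + 1) ∧
      ((∃ k : ℕ, (N i).relIndex (N (i + 1)) = p ^ k) ∨
        ((N i).relIndex (N (i + 1))).Coprime p)

/-- A subgroup `Q` of `P ≤ X` is picky (in `X`): `Q ≤ P^g` implies `P^g = P`, for all `g ∈ X`. -/
def IsPicky {X : Type*} [Group X] (P : Subgroup X) (Q : Subgroup P) : Prop :=
  ∀ g : X, Q.map P.subtype ≤ conjBy P g → conjBy P g = P

/-- The (finite, possibly empty) sums of characters of `P` induced from
characters of non-picky subgroups of `P`. -/
def sumsIndNonPicky {X : Type*} [Group X] (P : Subgroup X) : AddSubmonoid (P → ℂ) :=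
  AddSubmonoid.closure
    {f | ∃ (Q : Subgroup P) (θ : Q → ℂ), ¬ IsPicky P Q ∧ IsCharacterOrZero θ ∧ f = ind Q θ}

/-- `I(X, P, S)`: the additive group spanned by all `θ^X`, where `θ ∈ 𝒞(L)` for some subgroup
`L ≤ X` such that `L ∩ P ∈ Syl_p(L)` and `L ∩ P ∈ S`. -/
noncomputable def evI (p : ℕ) {X : Type*} [Group X] (P : Subgroup X) (S : Set (Subgroup X)) :
    AddSubgroup (X → ℂ) :=
  AddSubgroup.closure
    {f | ∃ (L : Subgroup X) (θ : L → ℂ), θ ∈ genChar L ∧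
      (∃ R : Sylow p L, (R : Subgroup L) = P.subgroupOf L) ∧ L ⊓ P ∈ S ∧ f = ind L θ}

/-- `S(G, P, H) = {Q ≤ P ∣ Q ≤ P^t for some t ∉ H}`. -/
def evS {G : Type*} [Group G] (P H : Subgroup G) : Set (Subgroup G) :=
  {Q | Q ≤ P ∧ ∃ t : G, t ∉ H ∧ Q ≤ conjBy P t}

/-- The condition (IRC-Syl) for `G`, `p` and `P ∈ Syl_p(G)`; with `H = N_G(P)`, there is a signed
bijection `F : ± Irr_{p'}(G) → ± Irr_{p'}(H)` with `F(χ) - χ_H ∈ I(H, P, S(G, P, H))`.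
Subgroups of `P` and of `H` are here regarded as subgroups of `G` or of `H` as appropriate. -/
def IRCSyl (p : ℕ) {G : Type*} [Group G] (P : Sylow p G) : Prop :=
  let H : Subgroup G := Subgroup.normalizer (P : Set G)
  ∃ F : (G → ℂ) → (H → ℂ),
    Set.BijOn F (SignedIrrPrime p G) (SignedIrrPrime p H) ∧
    ∀ χ ∈ SignedIrrPrime p G, F (-χ) = -F χ ∧
      F χ - res H χ ∈ evI p ((P : Subgroup G).subgroupOf H)
        {Q : Subgroup H | Q.map H.subtype ∈ evS (P : Subgroup G) H}

end EvseevPicky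

set_option linter.unusedSectionVars false

universe u

namespace EvseevPicky

open Representation

/-! ### Invariant subspaces, weight vectors and linear constituents -/

section RepBasics

variable {G V : Type*} [Group G] [AddCommGroup V] [Module ℂ V]

/-! The map sends χ to the only linear character of `P` occurring in χ_P. Induction on |G| shows
simultaneously that there is only one, that the rest of χ_P is a sum of characters induced from
non-picky subgroups, and that the linear constituent determines χ
(`IsPSolvable.hasUniqueLinearConstituent`). Let N ≠ 1 be a normal subgroup that is a p-group or a
p'-group.

If N is a p'-group, then C_N(P) = 1 because N_G(P) = P. Counting P-orbits on N gives ∑_{x ∈ N} χ(x)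
≡ χ(1) ≢ 0 mod p, so N has a nonzero fixed vector, hence acts trivially by irreducibility
(`apply_eq_one_of_coprime`). One passes to G/N, along which self-normalization is inherited and
non-picky subgroups pull back to non-picky ones.

If N is a p-group, then N ≤ P. As χ(1) is prime to p, χ_P has a linear constituent
(`IsPGroup.exists_isWeightVector`), whose restriction μ to N is P-invariant. If μ is G-invariant, N
acts by scalars, a power of the determinant extends μ to G, and a twist reduces to G/N. Otherwise
the module is the direct sum of weight spaces for G-conjugates of μ, and the stabilizer T < G of μ
acts irreducibly on the μ-space, where induction applies. The other weight spaces are permuted by P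
and contribute characters induced from their stabilizers in P. Sylow's theorem in T, with N_G(P) =
P, shows that these stabilizers are not picky and that μ is the only P-fixed conjugate
(`not_isPicky_of_smul_eq`, `HasUniqueLinearConstituent.of_stabRep`).

Surjectivity is Frobenius reciprocity: ν^G has degree |G : P|, so it has an irreducible constituent
of p'-degree. Finally (IRC-Syl) follows because H = P and F(χ) - χ_H = -Δ for χ ∈ Irr_{p'}(G). -/

theorem isIrreducible_iff (ρ : Representation ℂ G V) :
    ρ.IsIrreducible ↔ Nontrivial V ∧
      ∀ W : Submodule ℂ V, (∀ g, ∀ v ∈ W, ρ g v ∈ W) → W = ⊥ ∨ W = ⊤ := by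
  have hbot : (⊥ : Subrepresentation ρ).toSubmodule = ⊥ := rfl
  have htop : (⊤ : Subrepresentation ρ).toSubmodule = ⊤ := rfl
  constructor
  · intro h
    refine ⟨?_, fun W hW => ?_⟩
    · by_contra hV
      rw [not_nontrivial_iff_subsingleton] at hV
      exact bot_ne_top (α := Subrepresentation ρ)
        (Subrepresentation.toSubmodule_injective (Subsingleton.elim _ _))
    · rcases h.eq_bot_or_eq_top ⟨W, hW⟩ with h | h
      · exact Or.inl (by rw [← hbot, ← h])
      · exact Or.inr (by rw [← htop, ← h])
  · rintro ⟨_, h⟩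
    have : Nontrivial (Subrepresentation ρ) := ⟨⊥, ⊤, fun e => by
      have : (⊥ : Submodule ℂ V) = ⊤ := by rw [← hbot, ← htop, e]
      exact bot_ne_top this⟩
    refine ⟨fun W => ?_⟩
    rcases h W.toSubmodule W.apply_mem_toSubmodule with h | h
    · exact Or.inl (Subrepresentation.toSubmodule_injective h)
    · exact Or.inr (Subrepresentation.toSubmodule_injective h)

/-- An invariant submodule has an invariant complement. -/
theorem exists_invariant_isCompl [Finite G] (ρ : Representation ℂ G V) (W : Submodule ℂ V)
    (hW : ∀ g, ∀ v ∈ W, ρ g v ∈ W) :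
    ∃ W' : Submodule ℂ V, (∀ g, ∀ v ∈ W', ρ g v ∈ W') ∧ IsCompl W W' := by
  have : NeZero (Nat.card G : ℂ) := ⟨by exact_mod_cast Nat.card_pos.ne'⟩
  let S : Subrepresentation ρ := ⟨W, hW⟩
  obtain ⟨q, hq⟩ := MonoidAlgebra.Submodule.exists_isCompl (k := ℂ) (G := G) S.asSubmodule
  let S' : Subrepresentation ρ := Subrepresentation.ofSubmodule' q
  refine ⟨S'.toSubmodule, S'.apply_mem_toSubmodule, ?_⟩
  constructor
  · have h := Submodule.disjoint_def.1 hq.disjoint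
    exact Submodule.disjoint_def.2 h
  · have h := Submodule.codisjoint_iff_exists_add_eq.1 hq.codisjoint
    exact Submodule.codisjoint_iff_exists_add_eq.2 h

/-- The action on an invariant submodule. -/
def subRep (ρ : Representation ℂ G V) (W : Submodule ℂ V) (hW : ∀ g, ∀ v ∈ W, ρ g v ∈ W) :
    Representation ℂ G W :=
  (⟨W, hW⟩ : Subrepresentation ρ).toRepresentation

@[simp] theorem subRep_coe (ρ : Representation ℂ G V) (W : Submodule ℂ V)
    (hW : ∀ g, ∀ v ∈ W, ρ g v ∈ W) (g : G) (w : W) :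
    ((subRep ρ W hW g w : W) : V) = ρ g w := rfl

/-- Take an invariant subspace of least dimension among those of dimension prime to p. In any
invariant splitting U ⊕ U' of it, one summand again has dimension prime to p, so by minimality it is
everything. -/
theorem exists_irreducible_subRep [Finite G] [FiniteDimensional ℂ V] {p : ℕ}
    (ρ : Representation ℂ G V) (hp : ¬ p ∣ Module.finrank ℂ V) :
    ∃ (W : Submodule ℂ V) (hW : ∀ g, ∀ v ∈ W, ρ g v ∈ W),
      (subRep ρ W hW).IsIrreducible ∧ ¬ p ∣ Module.finrank ℂ W := by
  classical
  have hex : ∃ n, ∃ W : Submodule ℂ V, (∀ g, ∀ v ∈ W, ρ g v ∈ W) ∧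
      ¬ p ∣ Module.finrank ℂ W ∧ Module.finrank ℂ W = n :=
    ⟨_, ⊤, by simp, by simpa using hp, rfl⟩
  obtain ⟨W, hW, hpW, hn⟩ := Nat.find_spec hex
  refine ⟨W, hW, ?_, hpW⟩
  rw [isIrreducible_iff]
  constructor
  · by_contra hV
    rw [not_nontrivial_iff_subsingleton] at hV
    exact hpW (by rw [Module.finrank_zero_of_subsingleton]; exact dvd_zero p)
  · intro U hU
    obtain ⟨U', hU', hc⟩ := exists_invariant_isCompl (subRep ρ W hW) U hU
    have hadd := Submodule.finrank_add_eq_of_isCompl hc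
    have key : ∀ X : Submodule ℂ W, (∀ g, ∀ v ∈ X, subRep ρ W hW g v ∈ X) →
        ¬ p ∣ Module.finrank ℂ X → X = ⊤ := by
      intro X hX hpX
      have hfr : Module.finrank ℂ (X.map W.subtype) = Module.finrank ℂ X :=
        Submodule.finrank_map_subtype_eq W X
      have := Nat.find_min' hex ⟨X.map W.subtype, by
        rintro g _ ⟨x, hx, rfl⟩
        exact ⟨_, hX g x hx, rfl⟩, by rwa [hfr], rfl⟩
      rw [← hn, hfr] at this
      exact Submodule.eq_top_of_finrank_eq (le_antisymm (Submodule.finrank_le X) this)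
    by_cases h1 : p ∣ Module.finrank ℂ U
    · have h2 : ¬ p ∣ Module.finrank ℂ U' := fun h2 => hpW (hadd ▸ dvd_add h1 h2)
      have := key U' hU' h2
      left
      subst this
      simpa using hc.inf_eq_bot
    · exact Or.inr (key U hU h1)

/-- `v` is a vector on which `G` acts through the linear character `ν`. -/
def IsWeightVector (ρ : Representation ℂ G V) (ν : G →* ℂˣ) (v : V) : Prop :=
  v ≠ 0 ∧ ∀ g, ρ g v = (ν g : ℂ) • v

theorem finrank_eq_one_of_isWeightVector {ρ : Representation ℂ G V} (hρ : ρ.IsIrreducible)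
    {ν : G →* ℂˣ} {v : V} (hv : IsWeightVector ρ ν v) : Module.finrank ℂ V = 1 := by
  rw [isIrreducible_iff] at hρ
  have := (hρ.2 (ℂ ∙ v) (by
    intro g w hw
    obtain ⟨c, rfl⟩ := Submodule.mem_span_singleton.1 hw
    rw [map_smul, hv.2]
    exact Submodule.smul_mem _ _ (Submodule.smul_mem _ _ (Submodule.mem_span_singleton_self v)))
    ).resolve_left (by simpa using hv.1)
  rw [← finrank_top, ← this, finrank_span_singleton hv.1]

theorem character_eq_of_isWeightVector [FiniteDimensional ℂ V] {ρ : Representation ℂ G V}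
    (h1 : Module.finrank ℂ V = 1)
    {ν : G →* ℂˣ} {v : V} (hv : IsWeightVector ρ ν v) (g : G) : ρ.character g = ν g := by
  have : ρ g = (ν g : ℂ) • LinearMap.id := by
    ext w
    obtain ⟨c, rfl⟩ := (finrank_eq_one_iff_of_nonzero' v hv.1).1 h1 w
    simp [hv.2, smul_comm c]
  rw [Representation.character, this, map_smul, LinearMap.trace_id, h1]
  simp

/-- If every group element scales `v`, then it does so through a linear character. -/
theorem exists_isWeightVector {ρ : Representation ℂ G V} {v : V} (hv : v ≠ 0)
    (h : ∀ g, ∃ c : ℂ, ρ g v = c • v) : ∃ ν : G →* ℂˣ, IsWeightVector ρ ν v := by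
  choose c hc using h
  have hc1 : c 1 = 1 := by
    have := hc 1
    rw [map_one, Module.End.one_apply] at this
    exact smul_left_injective ℂ hv (by simpa using this.symm)
  have hcm : ∀ x y, c (x * y) = c x * c y := by
    intro x y
    apply smul_left_injective ℂ hv
    change c (x * y) • v = (c x * c y) • v
    rw [← hc, map_mul, Module.End.mul_apply, hc, map_smul, hc, smul_smul, mul_comm]
  let f : G →* ℂ := ⟨⟨c, hc1⟩, hcm⟩
  exact ⟨f.toHomUnits, hv, hc⟩

theorem IsWeightVector.ext {ρ : Representation ℂ G V} {ν ν' : G →* ℂˣ} {v : V}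
    (h : IsWeightVector ρ ν v) (h' : IsWeightVector ρ ν' v) : ν = ν' := by
  ext g
  exact smul_left_injective ℂ h.1 ((h.2 g).symm.trans (h'.2 g))

theorem exists_equiv_fin [FiniteDimensional ℂ V] (ρ : Representation ℂ G V) :
    ∃ (ρ' : Representation ℂ G (Fin (Module.finrank ℂ V) → ℂ)),
      ρ'.character = ρ.character ∧ (ρ.IsIrreducible → ρ'.IsIrreducible) ∧
      ∃ e : V ≃ₗ[ℂ] (Fin (Module.finrank ℂ V) → ℂ), ∀ g v, ρ' g (e v) = e (ρ g v) := by
  let e : V ≃ₗ[ℂ] (Fin (Module.finrank ℂ V) → ℂ) := (Module.finBasis ℂ V).equivFun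
  let ρ' : Representation ℂ G (Fin (Module.finrank ℂ V) → ℂ) :=
    { toFun := fun g => e.conj (ρ g)
      map_one' := by ext; simp [LinearEquiv.conj_apply]
      map_mul' := fun x y => by ext; simp [LinearEquiv.conj_apply] }
  have hρ' : ∀ g v, ρ' g (e v) = e (ρ g v) := fun g v => by
    change e.conj (ρ g) (e v) = _
    simp [LinearEquiv.conj_apply]
  refine ⟨ρ', ?_, ?_, e, hρ'⟩
  · ext g
    exact LinearMap.trace_conj' (ρ g) e
  · intro h
    rw [isIrreducible_iff] at h ⊢
    refine ⟨?_, fun W hW => ?_⟩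
    · have := h.1
      exact e.symm.toEquiv.nontrivial
    · have := h.2 (W.comap e.toLinearMap) (fun g v hv => by
        simp only [Submodule.mem_comap, LinearEquiv.coe_coe] at hv ⊢
        rw [← hρ']
        exact hW g _ hv)
      have hmap : (W.comap e.toLinearMap).map e.toLinearMap = W :=
        Submodule.map_comap_eq_of_surjective e.surjective W
      rcases this with h | h
      · left; rw [← hmap, h, Submodule.map_bot]
      · right; rw [← hmap, h, Submodule.map_top, LinearEquiv.range]

theorem isCharacterOrZero_character [FiniteDimensional ℂ V] (ρ : Representation ℂ G V) :
    IsCharacterOrZero ρ.character := by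
  obtain ⟨ρ', h, _⟩ := exists_equiv_fin ρ
  exact ⟨_, ρ', h.symm⟩

theorem character_mem_irr [FiniteDimensional ℂ V] {ρ : Representation ℂ G V}
    (hρ : ρ.IsIrreducible) : ρ.character ∈ Irr G := by
  obtain ⟨ρ', h, h', -⟩ := exists_equiv_fin ρ
  exact ⟨_, ρ', h' hρ, h.symm⟩

/-- A linear character is irreducible. -/
theorem linear_mem_irr (ν : G →* ℂˣ) : (fun g => (ν g : ℂ)) ∈ Irr G := by
  let ρ : Representation ℂ G ℂ :=
    (Algebra.lmul ℂ ℂ).toRingHom.toMonoidHom.comp ((Units.coeHom ℂ).comp ν)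
  have hv : IsWeightVector ρ ν (1 : ℂ) := ⟨one_ne_zero, fun g => by simp [ρ]⟩
  have hirr : ρ.IsIrreducible := by
    rw [isIrreducible_iff]
    refine ⟨inferInstance, fun W _ => ?_⟩
    exact eq_bot_or_eq_top (α := Ideal ℂ) W
  have : (fun g => (ν g : ℂ)) = ρ.character := by
    ext g
    exact (character_eq_of_isWeightVector (by simp) hv g).symm
  rw [this]
  exact character_mem_irr hirr

/-- Splitting off an invariant submodule from a character. -/
theorem exists_character_eq_add [Finite G] [FiniteDimensional ℂ V] (ρ : Representation ℂ G V)
    {W W' : Submodule ℂ V} (hW : ∀ g, ∀ v ∈ W, ρ g v ∈ W) (hW' : ∀ g, ∀ v ∈ W', ρ g v ∈ W')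
    (h : IsCompl W W') (g : G) :
    ρ.character g = (subRep ρ W hW).character g + (subRep ρ W' hW').character g := by
  let N : Bool → Submodule ℂ V := fun b => cond b W W'
  have hint : DirectSum.IsInternal N := by
    rw [DirectSum.isInternal_submodule_iff_isCompl N (i := true) (j := false) (by simp)
      (by ext b; cases b <;> simp)]
    exact h
  have := LinearMap.trace_eq_sum_trace_restrict hint (f := ρ g) (by
    rintro (_ | _)
    · exact hW' g
    · exact hW g)
  rw [Fintype.sum_bool] at this
  exact this

end RepBasics

/-! ### Clifford theory over linear characters of a normal subgroup -/

section Weights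

variable {G V : Type*} [Group G] {N : Subgroup G}

variable [AddCommGroup V] [Module ℂ V]

/-- The vectors on which the normal subgroup `N` acts through `μ`. -/
def weightSpace (ρ : Representation ℂ G V) (μ : N →* ℂˣ) : Submodule ℂ V where
  carrier := {v | ∀ n : N, ρ n v = (μ n : ℂ) • v}
  add_mem' {v w} hv hw n := by rw [map_add, hv n, hw n, smul_add]
  zero_mem' n := by simp
  smul_mem' c v hv n := by rw [map_smul, hv n, smul_comm]

section Normal

variable [N.Normal]

/-- The conjugation action on the linear characters of a normal subgroup. -/
instance conjAction : MulAction G (N →* ℂˣ) where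
  smul g μ := μ.comp (MulAut.conjNormal g⁻¹ : N ≃* N).toMonoidHom
  one_smul μ := by
    ext n
    change ((μ (MulAut.conjNormal (1 : G)⁻¹ n) : ℂˣ) : ℂ) = μ n
    simp
  mul_smul g h μ := by
    ext n
    change ((μ (MulAut.conjNormal (g * h)⁻¹ n) : ℂˣ) : ℂ) =
      μ (MulAut.conjNormal h⁻¹ (MulAut.conjNormal g⁻¹ n))
    rw [mul_inv_rev, map_mul, MulAut.mul_apply]

theorem conj_smul_apply (g : G) (μ : N →* ℂˣ) (n : N) :
    (g • μ) n = μ (MulAut.conjNormal g⁻¹ n) := rfl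

theorem map_mem_weightSpace {ρ : Representation ℂ G V} {μ : N →* ℂˣ} {v : V}
    (hv : v ∈ weightSpace ρ μ) (g : G) : ρ g v ∈ weightSpace ρ (g • μ) := by
  intro n
  have h := hv (MulAut.conjNormal g⁻¹ n)
  rw [conj_smul_apply, ← map_smul, ← h, ← Module.End.mul_apply, ← Module.End.mul_apply,
    ← map_mul, ← map_mul]
  congr 2
  rw [MulAut.conjNormal_apply]
  group

end Normal

variable [Fintype N]

/-- The projection onto `weightSpace ρ μ`. -/
noncomputable def weightProj (ρ : Representation ℂ G V) (μ : N →* ℂˣ) : Module.End ℂ V :=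
  (Nat.card N : ℂ)⁻¹ • ∑ n : N, ((μ n⁻¹ : ℂˣ) : ℂ) • ρ n

theorem weightProj_apply (ρ : Representation ℂ G V) (μ : N →* ℂˣ) (v : V) :
    weightProj ρ μ v = (Nat.card N : ℂ)⁻¹ • ∑ n : N, ((μ n⁻¹ : ℂˣ) : ℂ) • ρ n v := by
  simp [weightProj, LinearMap.sum_apply]

theorem weightProj_mem (ρ : Representation ℂ G V) (μ : N →* ℂˣ) (v : V) :
    weightProj ρ μ v ∈ weightSpace ρ μ := by
  intro m
  rw [weightProj_apply, map_smul, smul_comm (μ m : ℂ)]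
  congr 1
  rw [map_sum, Finset.smul_sum]
  refine Fintype.sum_equiv (Equiv.mulLeft m) _
    (fun n => (μ m : ℂ) • ((μ n⁻¹ : ℂˣ) : ℂ) • ρ n v) fun n => ?_
  rw [map_smul, ← Module.End.mul_apply, ← map_mul, smul_smul, ← Units.val_mul, ← map_mul]
  simp

theorem weightProj_of_mem {ρ : Representation ℂ G V} {μ : N →* ℂˣ} {v : V}
    (hv : v ∈ weightSpace ρ μ) : weightProj ρ μ v = v := by
  have hN : (Nat.card N : ℂ) ≠ 0 := by exact_mod_cast Nat.card_pos.ne'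
  rw [weightProj_apply]
  simp_rw [hv _, smul_smul, ← Units.val_mul, ← map_mul]
  simp [← Nat.cast_smul_eq_nsmul ℂ, smul_smul]

theorem weightProj_of_mem_of_ne {ρ : Representation ℂ G V} {μ μ' : N →* ℂˣ} (h : μ ≠ μ') {v : V}
    (hv : v ∈ weightSpace ρ μ') : weightProj ρ μ v = 0 := by
  rw [weightProj_apply]
  simp_rw [hv _, smul_smul, ← Finset.sum_smul]
  have := sum_hom_units_eq_zero ((Units.coeHom ℂ).comp (μ⁻¹ * μ')) (by
    intro e
    apply h
    ext n
    have h2 : ((μ n : ℂ))⁻¹ * (μ' n : ℂ) = 1 := by simpa using DFunLike.congr_fun e n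
    have h0 : (μ n : ℂ) ≠ 0 := Units.ne_zero _
    field_simp at h2
    exact h2.symm)
  have h3 : ∑ n : N, ((μ n⁻¹ : ℂˣ) : ℂ) * (μ' n : ℂ) = 0 := by
    rw [← this]
    exact Finset.sum_congr rfl fun n _ => by simp
  rw [h3, zero_smul, smul_zero]

theorem weightProj_mul_self (ρ : Representation ℂ G V) (μ : N →* ℂˣ) :
    weightProj ρ μ * weightProj ρ μ = weightProj ρ μ := by
  ext v
  exact weightProj_of_mem (weightProj_mem ρ μ v)

section Normal

variable [N.Normal]

theorem map_weightProj (ρ : Representation ℂ G V) (μ : N →* ℂˣ) (g : G) (v : V) :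
    ρ g (weightProj ρ μ v) = weightProj ρ (g • μ) (ρ g v) := by
  rw [weightProj_apply, weightProj_apply, map_smul, map_sum]
  congr 1
  refine Fintype.sum_equiv (MulAut.conjNormal g : N ≃* N).toEquiv _ _ fun n => ?_
  rw [map_smul, conj_smul_apply, ← Module.End.mul_apply, ← Module.End.mul_apply, ← map_mul,
    ← map_mul]
  congr 2
  · simp
  · simp

/-- With e the projection, the trace equals that of e x e, and x carries the μ-space into a
different weight space, which e kills. -/
theorem trace_eq_zero_of_smul_ne (ρ : Representation ℂ G V) {μ : N →* ℂˣ} {x : G}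
    (h : x • μ ≠ μ) : LinearMap.trace ℂ V (ρ x * weightProj ρ μ) = 0 := by
  rw [← weightProj_mul_self, ← mul_assoc, LinearMap.trace_mul_comm]
  have : weightProj ρ μ * (ρ x * weightProj ρ μ) = 0 := by
    ext v
    exact weightProj_of_mem_of_ne h.symm (map_mem_weightSpace (weightProj_mem ρ μ v) x)
  rw [this, map_zero]

theorem trace_conj_weightProj (ρ : Representation ℂ G V) (μ : N →* ℂˣ) (g x : G) :
    LinearMap.trace ℂ V (ρ (g * x * g⁻¹) * weightProj ρ (g • μ)) =
      LinearMap.trace ℂ V (ρ x * weightProj ρ μ) := by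
  have : ρ (g * x * g⁻¹) * weightProj ρ (g • μ) = ρ g * ((ρ x * weightProj ρ μ) * ρ g⁻¹) := by
    ext v
    simp only [map_mul, Module.End.mul_apply]
    rw [map_weightProj ρ (g • μ), inv_smul_smul]
  rw [this, LinearMap.trace_mul_comm, mul_assoc, ← map_mul]
  simp

section HomRep

variable {H : Type*} [Group H]

/-- A group mapping to the stabilizer of `μ` acts on the weight space of `μ`. -/
def weightRep (ρ : Representation ℂ G V) (μ : N →* ℂˣ) (f : H →* G) (hf : ∀ h, f h • μ = μ) :
    Representation ℂ H (weightSpace ρ μ) :=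
  subRep (ρ.comp f) (weightSpace ρ μ) fun h v hv => by
    have := map_mem_weightSpace hv (f h)
    rwa [hf] at this

@[simp] theorem weightRep_coe (ρ : Representation ℂ G V) (μ : N →* ℂˣ) (f : H →* G)
    (hf : ∀ h, f h • μ = μ) (h : H) (v : weightSpace ρ μ) :
    ((weightRep ρ μ f hf h v : weightSpace ρ μ) : V) = ρ (f h) v := rfl

/-- Rewriting the character as a trace on all of V lets the contributions of different weight spaces
be compared without changing the ambient space. -/
theorem character_weightRep [FiniteDimensional ℂ V] (ρ : Representation ℂ G V) (μ : N →* ℂˣ)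
    (f : H →* G) (hf : ∀ h, f h • μ = μ) (h : H) :
    (weightRep ρ μ f hf).character h = LinearMap.trace ℂ V (ρ (f h) * weightProj ρ μ) := by
  have hmem : ∀ v, (ρ (f h) * weightProj ρ μ) v ∈ weightSpace ρ μ := fun v => by
    have := map_mem_weightSpace (weightProj_mem ρ μ v) (f h)
    rwa [hf] at this
  rw [← LinearMap.trace_restrict_eq_of_forall_mem (weightSpace ρ μ) _ hmem]
  rw [Representation.character]
  congr 1
  ext v
  simp [weightProj_of_mem v.2]

end HomRep

theorem finrank_weightSpace [FiniteDimensional ℂ V] (ρ : Representation ℂ G V) (μ : N →* ℂˣ) :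
    (Module.finrank ℂ (weightSpace ρ μ) : ℂ) = LinearMap.trace ℂ V (weightProj ρ μ) := by
  -- The trivial group maps into every stabilizer, and its character at the identity is the
  -- dimension.
  have := character_weightRep ρ μ (1 : Unit →* G) (fun h => by simp) ()
  rw [MonoidHom.one_apply, map_one, one_mul] at this
  rw [← this, ← Representation.char_one (weightRep ρ μ (1 : Unit →* G) (fun h => by simp))]

theorem finrank_weightSpace_smul [FiniteDimensional ℂ V] (ρ : Representation ℂ G V)
    (μ : N →* ℂˣ) (g : G) :
    Module.finrank ℂ (weightSpace ρ (g • μ)) = Module.finrank ℂ (weightSpace ρ μ) := by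
  have := trace_conj_weightProj ρ μ g 1
  rw [mul_one, mul_inv_cancel, map_one, one_mul, one_mul, ← finrank_weightSpace,
    ← finrank_weightSpace] at this
  exact_mod_cast this

/-- The sum commutes with G, which only permutes the projections, so its fixed vectors form an
invariant subspace, nonzero because it contains the μ-space. -/
theorem sum_weightProj [Fintype (N →* ℂˣ)] {ρ : Representation ℂ G V} (hρ : ρ.IsIrreducible)
    {μ : N →* ℂˣ} (hμ : weightSpace ρ μ ≠ ⊥) : ∑ μ' : N →* ℂˣ, weightProj ρ μ' = 1 := by
  rw [isIrreducible_iff] at hρ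
  set E := ∑ μ' : N →* ℂˣ, weightProj ρ μ' with hE
  have hEg : ∀ g v, ρ g (E v) = E (ρ g v) := by
    intro g v
    rw [hE, LinearMap.sum_apply, LinearMap.sum_apply, map_sum]
    exact Fintype.sum_equiv (MulAction.toPerm g) _ _ fun μ' => map_weightProj ρ μ' g v
  have hfix : ∀ v ∈ weightSpace ρ μ, E v = v := by
    intro v hv
    rw [hE, LinearMap.sum_apply, Finset.sum_eq_single μ]
    · exact weightProj_of_mem hv
    · intro b _ hb
      exact weightProj_of_mem_of_ne hb hv
    · simp
  have := (hρ.2 (LinearMap.ker (E - 1)) (fun g v hv => by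
    rw [LinearMap.mem_ker, LinearMap.sub_apply, Module.End.one_apply, sub_eq_zero] at hv ⊢
    rw [← hEg, hv])).resolve_left (by
      intro h0
      apply hμ
      rw [eq_bot_iff, ← h0]
      intro v hv
      simp [hfix v hv])
  rw [LinearMap.ker_eq_top, sub_eq_zero] at this
  exact this

/-- The vectors killed by all projections outside the orbit of μ form an invariant subspace
containing the μ-space. By irreducibility it is everything. -/
theorem mem_orbit_of_weightSpace_ne_bot {ρ : Representation ℂ G V} (hρ : ρ.IsIrreducible)
    {μ μ' : N →* ℂˣ} (hμ : weightSpace ρ μ ≠ ⊥) (hμ' : weightSpace ρ μ' ≠ ⊥) :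
    μ' ∈ MulAction.orbit G μ := by
  rw [isIrreducible_iff] at hρ
  by_contra hno
  let W : Submodule ℂ V :=
    { carrier := {v | ∀ b ∉ MulAction.orbit G μ, weightProj ρ b v = 0}
      add_mem' := fun hv hw b hb => by rw [map_add, hv b hb, hw b hb, add_zero]
      zero_mem' := fun b _ => map_zero _
      smul_mem' := fun c v hv b hb => by rw [map_smul, hv b hb, smul_zero] }
  have hW := hρ.2 W (fun g v hv b hb => by
    have h1 := hv (g⁻¹ • b) (fun ⟨k, hk⟩ => hb ⟨g * k, by
      change (g * k) • μ = b
      rw [mul_smul]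
      exact smul_eq_iff_eq_inv_smul g |>.2 hk⟩)
    have h2 := map_weightProj ρ (g⁻¹ • b) g v
    rwa [h1, map_zero, smul_inv_smul, eq_comm] at h2)
  rcases hW with hW | hW
  · apply hμ
    rw [eq_bot_iff, ← hW]
    intro v hv b hb
    exact weightProj_of_mem_of_ne (fun e : b = μ => hb
      (e.symm ▸ MulAction.mem_orbit_self μ)) hv
  · apply hμ'
    rw [eq_bot_iff]
    intro v hv
    have : v ∈ W := hW ▸ Submodule.mem_top
    rw [Submodule.mem_bot, ← weightProj_of_mem hv]
    exact this μ' hno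

theorem character_eq_sum_trace [Fintype (N →* ℂˣ)] {ρ : Representation ℂ G V}
    (hρ : ρ.IsIrreducible) {μ : N →* ℂˣ} (hμ : weightSpace ρ μ ≠ ⊥) (x : G) :
    ρ.character x = ∑ μ' : N →* ℂˣ, LinearMap.trace ℂ V (ρ x * weightProj ρ μ') := by
  rw [← map_sum, ← Finset.mul_sum, sum_weightProj hρ hμ, mul_one, Representation.character]

/-- The nonzero weight spaces are conjugate, hence of equal dimension, and their dimensions add up
to that of V. -/
theorem finrank_weightSpace_dvd [Finite (N →* ℂˣ)] [FiniteDimensional ℂ V]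
    {ρ : Representation ℂ G V}
    (hρ : ρ.IsIrreducible) {μ : N →* ℂˣ} (hμ : weightSpace ρ μ ≠ ⊥) :
    Module.finrank ℂ (weightSpace ρ μ) ∣ Module.finrank ℂ V := by
  have := Fintype.ofFinite (N →* ℂˣ)
  have h := character_eq_sum_trace hρ hμ 1
  simp_rw [Representation.char_one, map_one, one_mul, ← finrank_weightSpace] at h
  norm_cast at h
  rw [h]
  refine Finset.dvd_sum fun b _ => ?_
  by_cases hb : weightSpace ρ b = ⊥
  · rw [hb, finrank_bot]
    exact dvd_zero _
  · obtain ⟨g, rfl⟩ := mem_orbit_of_weightSpace_ne_bot hρ hμ hb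
    change _ ∣ Module.finrank ℂ (weightSpace ρ (g • μ))
    rw [finrank_weightSpace_smul]

/-- For a stable U in the μ-space, let W consist of the vectors all of whose translates project into
U. It is G-invariant and contains U, since elements outside the stabilizer move the μ-space into
other weight spaces. Moreover W meets the μ-space inside U, so W = 0 or W = V decides U. -/
theorem isIrreducible_weightRep {ρ : Representation ℂ G V} (hρ : ρ.IsIrreducible)
    {μ : N →* ℂˣ} (hμ : weightSpace ρ μ ≠ ⊥) :
    (weightRep ρ μ (MulAction.stabilizer G μ).subtype fun h => h.2).IsIrreducible := by
  rw [isIrreducible_iff] at hρ ⊢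
  refine ⟨Submodule.nontrivial_iff_ne_bot.2 hμ, fun U hU => ?_⟩
  let U' : Submodule ℂ V := U.map (weightSpace ρ μ).subtype
  let W : Submodule ℂ V := ⨅ g : G, U'.comap (weightProj ρ μ * ρ g)
  have memW : ∀ v, v ∈ W ↔ ∀ g, weightProj ρ μ (ρ g v) ∈ U' := fun v => by
    simp [W, Submodule.mem_iInf]
  have hW := hρ.2 W (fun g v hv => by
    rw [memW] at hv ⊢
    intro h
    rw [← Module.End.mul_apply (ρ h), ← map_mul]
    exact hv _)
  have hUW : U' ≤ W := by
    rintro _ ⟨u, hu, rfl⟩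
    rw [memW]
    intro g
    by_cases hg : g • μ = μ
    · refine ⟨_, hU ⟨g, hg⟩ u hu, ?_⟩
      have := map_mem_weightSpace u.2 g
      rw [hg] at this
      exact (weightProj_of_mem this).symm
    · have := weightProj_of_mem_of_ne (Ne.symm hg) (map_mem_weightSpace u.2 g)
      simp only [Submodule.subtype_apply]
      rw [this]
      exact zero_mem _
  rcases hW with hW | hW
  · left
    rw [hW, le_bot_iff] at hUW
    exact Submodule.map_injective_of_injective (weightSpace ρ μ).subtype_injective
      (hUW.trans (Submodule.map_bot _).symm)
  · right
    rw [eq_top_iff]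
    intro v _
    have : (v : V) ∈ W := hW ▸ Submodule.mem_top
    have := (memW _).1 this 1
    rw [map_one, Module.End.one_apply, weightProj_of_mem v.2] at this
    obtain ⟨u, hu, huv⟩ := this
    rwa [← Subtype.ext huv]

end Normal

end Weights

/-! ### Sums over orbits and induced functions -/

section OrbitSums

variable {P Y : Type*} [Group P] [MulAction P Y]

theorem sum_smul_eq_card_stabilizer_nsmul [Fintype P] [DecidableEq Y] {R : Type*}
    [AddCommMonoid R] (f : Y → R) (b : Y) :
    ∑ g : P, f (g • b) = Nat.card (MulAction.stabilizer P b) •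
      ∑ y ∈ Finset.univ.image (fun g : P => g • b), f y := by
  rw [Finset.sum_comp f (fun g : P => g • b), Finset.smul_sum]
  refine Finset.sum_congr rfl fun y hy => ?_
  obtain ⟨h, -, rfl⟩ := Finset.mem_image.1 hy
  congr 1
  rw [← Fintype.card_coe, ← Nat.card_eq_fintype_card]
  exact Nat.card_congr
    { toFun := fun a => ⟨h⁻¹ * a, by
        have := a.2
        simp only [Finset.mem_filter, Finset.mem_univ, true_and] at this
        rw [MulAction.mem_stabilizer_iff, mul_smul, this, inv_smul_smul]⟩
      invFun := fun s => ⟨h * s, by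
        have := s.2
        rw [MulAction.mem_stabilizer_iff] at this
        simp [mul_smul, this]⟩
      left_inv := fun a => by simp
      right_inv := fun s => by simp }

theorem sum_eq_sum_orbits [Fintype P] [Fintype Y] [DecidableEq Y]
    [Fintype (MulAction.orbitRel.Quotient P Y)] {R : Type*} [AddCommMonoid R] (f : Y → R) :
    ∑ y, f y = ∑ ω : MulAction.orbitRel.Quotient P Y,
      ∑ y ∈ Finset.univ.image (fun g : P => g • ω.out), f y := by
  classical
  rw [← Finset.sum_fiberwise Finset.univ
    (fun y => (Quotient.mk'' y : MulAction.orbitRel.Quotient P Y)) f]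
  refine Finset.sum_congr rfl fun ω _ => Finset.sum_congr ?_ fun _ _ => rfl
  ext y
  simp only [Finset.mem_filter, Finset.mem_univ, true_and, Finset.mem_image]
  constructor
  · intro h
    have h2 : (Quotient.mk'' y : MulAction.orbitRel.Quotient P Y) = Quotient.mk'' ω.out := by
      rw [h, Quotient.mk''_eq_mk, Quotient.out_eq]
    exact MulAction.orbitRel_apply.1 (Quotient.eq''.1 h2)
  · rintro ⟨g, rfl⟩
    rw [← Quotient.out_eq ω]
    exact Quotient.eq''.2 (MulAction.orbitRel_apply.2 ⟨g, by simp⟩)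

/-- A sum over a finite set of a function invariant under a `p`-group and vanishing at
the fixed points is divisible by `p`. -/
theorem dvd_sum_of_eq_zero_of_fixed {p : ℕ} [Fact p.Prime] [Finite P] [Fintype Y]
    (hP : IsPGroup p P) {R : Type*} [CommRing R] (f : Y → R) (hf : ∀ (g : P) y, f (g • y) = f y)
    (h0 : ∀ y, (∀ g : P, g • y = y) → f y = 0) : (p : R) ∣ ∑ y, f y := by
  classical
  have := Fintype.ofFinite P
  rw [sum_eq_sum_orbits (P := P) f]
  refine Finset.dvd_sum fun ω _ => ?_
  generalize ω.out = b
  rw [Finset.sum_congr rfl (g := fun _ => f b) (by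
    intro y hy
    obtain ⟨g, -, rfl⟩ := Finset.mem_image.1 hy
    exact hf g b), Finset.sum_const]
  by_cases hb : ∀ g : P, g • b = b
  · rw [h0 b hb, smul_zero]
    exact dvd_zero _
  · rw [nsmul_eq_mul]
    refine Dvd.dvd.mul_right (Nat.cast_dvd_cast ?_) _
    obtain ⟨n, hn⟩ := hP.card_orbit b
    have hcard : (Finset.univ.image (fun g : P => g • b)).card = p ^ n := by
      rw [← hn, ← Fintype.card_coe, ← Nat.card_eq_fintype_card]
      refine Nat.card_congr (Equiv.subtypeEquivRight fun y => ?_)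
      simp [MulAction.mem_orbit_iff]
    rw [hcard]
    rcases n with _ | n
    · exfalso
      apply hb
      intro g
      rw [pow_zero, Finset.card_eq_one] at hcard
      obtain ⟨a, ha⟩ := hcard
      have h1 : g • b ∈ Finset.univ.image (fun g : P => g • b) :=
        Finset.mem_image_of_mem _ (Finset.mem_univ g)
      have h2 : (1 : P) • b ∈ Finset.univ.image (fun g : P => g • b) :=
        Finset.mem_image_of_mem _ (Finset.mem_univ 1)
      rw [ha, Finset.mem_singleton] at h1 h2
      rw [h1, ← h2, one_smul]
    · exact dvd_pow_self p n.succ_ne_zero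

theorem ind_apply [Fintype P] (L : Subgroup P) (θ : L → ℂ) (F : P → ℂ) (hF : ∀ l : L, F l = θ l)
    (hF0 : ∀ x ∉ L, F x = 0) (x : P) :
    ind L θ x = (Nat.card L : ℂ)⁻¹ * ∑ y : P, F (y⁻¹ * x * y) := by
  classical
  rw [ind, finsum_eq_sum_of_fintype]
  congr 1
  refine Finset.sum_congr rfl fun y _ => ?_
  split_ifs with h
  · exact (hF ⟨_, h⟩).symm
  · exact (hF0 _ h).symm

/-- Think of `c x y` as the trace of x on the block indexed by y of a module whose blocks are
permuted by P. One orbit of blocks then carries the function induced from the stabilizer of a single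
block. -/
theorem ind_stabilizer_apply [Fintype P] [DecidableEq Y] (c : P → Y → ℂ)
    (h0 : ∀ x y, x • y ≠ y → c x y = 0)
    (hc : ∀ g x y, c (g * x * g⁻¹) (g • y) = c x y) (b : Y) (x : P) :
    ind (MulAction.stabilizer P b) (fun q => c q b) x =
      ∑ y ∈ Finset.univ.image (fun g : P => g • b), c x y := by
  rw [ind_apply _ _ (fun x => c x b) (fun _ => rfl) (fun x hx => h0 x b hx)]
  have : ∀ y : P, c (y⁻¹ * x * y) b = c x (y • b) := fun y => by
    rw [← hc y]
    congr 1
    group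
  simp_rw [this]
  rw [sum_smul_eq_card_stabilizer_nsmul (fun z => c x z), nsmul_eq_mul, ← mul_assoc,
    inv_mul_cancel₀ (by exact_mod_cast Nat.card_pos.ne'), one_mul]

theorem sum_mem_of_ind_stabilizer_mem [Finite P] [Fintype Y] (c : P → Y → ℂ)
    (h0 : ∀ x y, x • y ≠ y → c x y = 0)
    (hc : ∀ g x y, c (g * x * g⁻¹) (g • y) = c x y) (S : AddSubmonoid (P → ℂ))
    (hS : ∀ b, ind (MulAction.stabilizer P b) (fun q => c q b) ∈ S) :
    (fun x => ∑ y, c x y) ∈ S := by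
  classical
  have := Fintype.ofFinite P
  have : (fun x => ∑ y, c x y) = ∑ ω : MulAction.orbitRel.Quotient P Y,
      ind (MulAction.stabilizer P ω.out) (fun q => c q ω.out) := by
    ext x
    rw [Finset.sum_apply, sum_eq_sum_orbits (P := P)]
    exact Finset.sum_congr rfl fun ω _ => (ind_stabilizer_apply c h0 hc _ x).symm
  rw [this]
  exact sum_mem fun ω _ => hS _

end OrbitSums

/-! ### Linear constituents for p-groups -/

section PGroup

variable {G V : Type*} [Group G] [AddCommGroup V] [Module ℂ V]

theorem map_sum_weightProj {N : Subgroup G} [N.Normal] [Fintype N] [Fintype (N →* ℂˣ)]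
    (ρ : Representation ℂ G V) (g : G) (v : V) :
    ρ g ((∑ μ : N →* ℂˣ, weightProj ρ μ) v) = (∑ μ : N →* ℂˣ, weightProj ρ μ) (ρ g v) := by
  rw [LinearMap.sum_apply, LinearMap.sum_apply, map_sum]
  exact Fintype.sum_equiv (MulAction.toPerm g) _ _ fun μ' => map_weightProj ρ μ' g v

theorem sum_weightProj_of_mem {N : Subgroup G} [N.Normal] [Fintype N] [Fintype (N →* ℂˣ)]
    {ρ : Representation ℂ G V} {μ : N →* ℂˣ} {v : V} (hv : v ∈ weightSpace ρ μ) :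
    (∑ μ : N →* ℂˣ, weightProj ρ μ) v = v := by
  rw [LinearMap.sum_apply, Finset.sum_eq_single μ]
  · exact weightProj_of_mem hv
  · intro b _ hb
    exact weightProj_of_mem_of_ne hb hv
  · simp

/-- A representation of a finite `p`-group of dimension prime to `p` has a one-dimensional
subrepresentation. -/
theorem IsPGroup.exists_isWeightVector {p : ℕ} [Fact p.Prime] {P : Type*} [Group P] [Finite P]
    (hP : IsPGroup p P) {V : Type*} [AddCommGroup V] [Module ℂ V] [FiniteDimensional ℂ V]
    (ρ : Representation ℂ P V) (hV : ¬ p ∣ Module.finrank ℂ V) :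
    ∃ (ν : P →* ℂˣ) (v : V), IsWeightVector ρ ν v := by
  classical
  induction hn : Nat.card P using Nat.strong_induction_on generalizing P V with
  | _ n ih =>
  have hpp : p.Prime := Fact.out
  obtain ⟨k, hk⟩ := IsPGroup.iff_card.1 hP
  rcases k with _ | k
  · have : Subsingleton P := (Nat.card_eq_one_iff_unique.1 (by simpa using hk)).1
    have : Nontrivial V := by
      by_contra h
      rw [not_nontrivial_iff_subsingleton] at h
      exact hV (by rw [Module.finrank_zero_of_subsingleton]; exact dvd_zero p)
    obtain ⟨v, hv⟩ := exists_ne (0 : V)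
    refine ⟨1, v, hv, fun g => ?_⟩
    rw [Subsingleton.elim g 1]
    simp
  by_contra hno
  push Not at hno
  -- M is a maximal subgroup, of index p and therefore normal.
  obtain ⟨M, hM⟩ := Sylow.exists_subgroup_card_pow_prime p (G := P) (n := k)
    (hk ▸ pow_dvd_pow p k.le_succ)
  have hidx : M.index = p := by
    have := M.card_mul_index
    rw [hM, hk, pow_succ] at this
    exact Nat.eq_of_mul_eq_mul_left (pow_pos hpp.pos k) this
  have hMn : M.Normal := Subgroup.normal_of_index_eq_minFac_card (by
    rw [hidx, hk, hpp.pow_minFac k.succ_ne_zero])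
  have := Fintype.ofFinite M
  have := Fintype.ofFinite (M →* ℂˣ)
  -- A nonzero weight space for a P-invariant μ would contain an eigenvector of some x ∉ M, and this
  -- would be a weight vector for P.
  have hfix : ∀ μ : M →* ℂˣ, (∀ g : P, g • μ = μ) → weightSpace ρ μ = ⊥ := by
    intro μ hμ
    by_contra hne
    have : Nontrivial (weightSpace ρ μ) := Submodule.nontrivial_iff_ne_bot.2 hne
    obtain ⟨x, hx⟩ : ∃ x, x ∉ M := by
      by_contra! h
      rw [(Subgroup.eq_top_iff' M).2 h, Subgroup.index_top] at hidx
      exact hpp.one_lt.ne hidx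
    obtain ⟨c, hc⟩ := Module.End.exists_eigenvalue (weightRep ρ μ (MonoidHom.id P) hμ x)
    obtain ⟨v, hv⟩ := hc.exists_hasEigenvector
    have hv0 : (v : V) ≠ 0 := fun h => hv.2 (Subtype.ext h)
    have hxv : ρ x v = c • (v : V) := congrArg Subtype.val hv.apply_eq_smul
    -- The elements having v as an eigenvector form a subgroup containing M and x, so all of P
    -- because |P : M| is prime.
    let K : Subgroup P :=
      { carrier := {g | ∃ c : ℂ, ρ g v = c • (v : V)}
        mul_mem' := by
          rintro g h ⟨a, ha⟩ ⟨b, hb⟩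
          exact ⟨b * a, by rw [map_mul, Module.End.mul_apply, hb, map_smul, ha, smul_smul]⟩
        one_mem' := ⟨1, by simp⟩
        inv_mem' := by
          rintro g ⟨a, ha⟩
          have ha0 : a ≠ 0 := by
            rintro rfl
            rw [zero_smul] at ha
            exact hv0 ((ρ.apply_bijective g).1 (ha.trans (map_zero _).symm))
          refine ⟨a⁻¹, ?_⟩
          rw [inv_apply_eq_iff, map_smul, ha, smul_smul, inv_mul_cancel₀ ha0, one_smul] }
    have hMK : M ≤ K := fun m hm => ⟨_, v.2 ⟨m, hm⟩⟩
    have hKtop : K = ⊤ := by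
      rw [← Subgroup.index_eq_one]
      have h1 := Subgroup.relIndex_mul_index hMK
      rw [hidx] at h1
      rcases (Nat.dvd_prime hpp).1 (Dvd.intro_left _ h1) with h | h
      · exact h
      · rw [h] at h1
        have h2 : M.relIndex K = 1 := Nat.eq_of_mul_eq_mul_right hpp.pos (by rw [h1, one_mul])
        rw [Subgroup.relIndex_eq_one] at h2
        exact absurd (h2 ⟨c, hxv⟩) hx
    obtain ⟨ν, hν⟩ := EvseevPicky.exists_isWeightVector (ρ := ρ) hv0 (fun g => by
      have : g ∈ K := hKtop ▸ Subgroup.mem_top g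
      exact this)
    exact hno ν v hν
  -- Only characters of M in nontrivial P-orbits contribute, and those orbits have length divisible
  -- by p.
  have h1 : (p : ℤ) ∣ ∑ μ : M →* ℂˣ, (Module.finrank ℂ (weightSpace ρ μ) : ℤ) :=
    dvd_sum_of_eq_zero_of_fixed hP _ (fun g μ => by rw [finrank_weightSpace_smul])
      (fun μ hμ => by rw [hfix μ hμ, finrank_bot]; rfl)
  have h1' : p ∣ ∑ μ : M →* ℂˣ, Module.finrank ℂ (weightSpace ρ μ) := by exact_mod_cast h1
  set E := ∑ μ : M →* ℂˣ, weightProj ρ μ with hE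
  have hproj : LinearMap.IsProj (LinearMap.range E) E := by
    refine ⟨fun v => ⟨v, rfl⟩, ?_⟩
    rintro _ ⟨v, rfl⟩
    have : E v = ∑ μ : M →* ℂˣ, weightProj ρ μ v := by rw [hE, LinearMap.sum_apply]
    rw [this, map_sum]
    exact Finset.sum_congr rfl fun μ _ => sum_weightProj_of_mem (weightProj_mem ρ μ v)
  have hrange : Module.finrank ℂ (LinearMap.range E) =
      ∑ μ : M →* ℂˣ, Module.finrank ℂ (weightSpace ρ μ) := by
    have := hproj.trace
    rw [hE, map_sum] at this
    simp_rw [← finrank_weightSpace] at this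
    exact_mod_cast this.symm
  have hadd := LinearMap.finrank_range_add_finrank_ker E
  -- The weight spaces of M together have dimension divisible by p, so their invariant complement,
  -- the kernel of E, has dimension prime to p. Induction yields a weight vector of M there, but E
  -- fixes all such vectors.
  have hker : ¬ p ∣ Module.finrank ℂ (LinearMap.ker E) := fun h =>
    hV (hadd ▸ dvd_add (hrange ▸ h1') h)
  obtain ⟨μ, w, hw0, hw⟩ := ih (Nat.card M) (by
      rw [← hn, hM, hk]
      exact Nat.pow_lt_pow_right hpp.one_lt k.lt_succ_self) (hP.to_subgroup M)
    (subRep (ρ.comp M.subtype) (LinearMap.ker E) fun m v hv => by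
      rw [LinearMap.mem_ker] at hv ⊢
      change E (ρ m v) = 0
      rw [hE, ← map_sum_weightProj, ← hE, hv, map_zero]) hker rfl
  apply hw0
  have hmem : (w : V) ∈ weightSpace ρ μ := fun m => congrArg Subtype.val (hw m)
  have h2 := sum_weightProj_of_mem hmem
  rw [← hE, LinearMap.mem_ker.1 w.2] at h2
  exact Subtype.ext h2.symm

end PGroup

/-! ### Inheritance of p-solvability -/

section Solvable

variable {p : ℕ} [Fact p.Prime] {G H : Type*} [Group G] [Group H]

theorem primePow_or_coprime_of_dvd {a b : ℕ} (hab : a ∣ b)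
    (hb : (∃ k, b = p ^ k) ∨ b.Coprime p) : (∃ k, a = p ^ k) ∨ a.Coprime p := by
  rcases hb with ⟨k, rfl⟩ | h
  · obtain ⟨j, -, hj⟩ := (Nat.dvd_prime_pow Fact.out).1 hab
    exact Or.inl ⟨j, hj⟩
  · exact Or.inr (h.coprime_dvd_left hab)

theorem IsPSolvable.subgroup (h : IsPSolvable p G) (T : Subgroup G) : IsPSolvable p T := by
  obtain ⟨n, N, h0, hn, hnorm, hN⟩ := h
  refine ⟨n, fun i => (N i).subgroupOf T, by simp [h0], by simp [hn], fun i => ?_, fun i hi => ?_⟩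
  · have := hnorm i
    infer_instance
  · obtain ⟨hle, hidx⟩ := hN i hi
    refine ⟨Subgroup.comap_mono hle, primePow_or_coprime_of_dvd ?_ hidx⟩
    change ((N i).comap T.subtype).relIndex _ ∣ _
    rw [Subgroup.relIndex_comap]
    have hle' : ((N (i + 1)).subgroupOf T).map T.subtype ≤ N (i + 1) := Subgroup.map_comap_le _ _
    have := hnorm i
    rw [← Subgroup.relIndex_subgroupOf hle']
    exact Subgroup.relIndex_dvd_index_of_normal _ _

theorem IsPSolvable.map (h : IsPSolvable p G) (f : G →* H) (hf : Function.Surjective f) :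
    IsPSolvable p H := by
  obtain ⟨n, N, h0, hn, hnorm, hN⟩ := h
  refine ⟨n, fun i => (N i).map f, by simp [h0], ?_, fun i => (hnorm i).map f hf, fun i hi => ?_⟩
  · change (N n).map f = ⊤
    rw [hn, ← MonoidHom.range_eq_map, MonoidHom.range_eq_top.2 hf]
  · obtain ⟨hle, hidx⟩ := hN i hi
    refine ⟨Subgroup.map_mono hle, primePow_or_coprime_of_dvd ?_ hidx⟩
    have := hnorm i
    have hsup : N (i + 1) ⊔ f.ker = N (i + 1) ⊔ (N i ⊔ f.ker) := by
      rw [← sup_assoc, sup_eq_left.2 hle]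
    rw [Subgroup.relIndex_map_map, hsup, Subgroup.relIndex_sup_right]
    exact Subgroup.relIndex_dvd_of_le_left _ le_sup_left

/-- The first nontrivial term of the series is isomorphic to the factor ending at it. -/
theorem IsPSolvable.exists_normal [Nontrivial G] (h : IsPSolvable p G) :
    ∃ N : Subgroup G, N.Normal ∧ N ≠ ⊥ ∧ (IsPGroup p N ∨ (Nat.card N).Coprime p) := by
  classical
  obtain ⟨n, N, h0, hn, hnorm, hN⟩ := h
  have hex : ∃ i, N i ≠ ⊥ := ⟨n, by rw [hn]; exact top_ne_bot⟩
  have hspec := Nat.find_spec hex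
  have hmin := fun m (hm : m < Nat.find hex) => not_not.1 (Nat.find_min hex hm)
  have hle : Nat.find hex ≤ n := Nat.find_min' hex (by rw [hn]; exact top_ne_bot)
  generalize Nat.find hex = i at *
  rcases i with _ | i
  · exact absurd h0 hspec
  · refine ⟨N (i + 1), hnorm _, hspec, ?_⟩
    obtain ⟨-, hidx⟩ := hN i hle
    rw [hmin i i.lt_succ_self, Subgroup.relIndex_bot_left] at hidx
    rcases hidx with ⟨k, hk⟩ | h
    · exact Or.inl (IsPGroup.of_card hk)
    · exact Or.inr h

end Solvable

/-! ### Self-normalizing Sylow subgroups and picky subgroups -/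

section Sylow

variable {p : ℕ} [Fact p.Prime] {G H : Type*} [Group G] [Finite G] [Group H] [Finite H]

theorem mem_conjBy {P : Subgroup G} {g x : G} : x ∈ conjBy P g ↔ g * x * g⁻¹ ∈ P := by
  rw [conjBy, Subgroup.mem_map]
  constructor
  · rintro ⟨y, hy, rfl⟩
    simpa [mul_assoc] using hy
  · intro h
    exact ⟨_, h, by simp [mul_assoc]⟩

theorem mem_normalizer_of_conj_mem {P : Subgroup G} {g : G} (h : ∀ x ∈ P, g * x * g⁻¹ ∈ P) :
    g ∈ Subgroup.normalizer (P : Set G) :=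
  Subgroup.mem_normalizer_fintype h

theorem conjBy_eq_iff {P : Subgroup G} {g : G} :
    conjBy P g = P ↔ g ∈ Subgroup.normalizer (P : Set G) := by
  rw [Subgroup.mem_normalizer_iff, SetLike.ext_iff]
  simp only [mem_conjBy]
  exact forall_congr' fun x => Iff.comm

/-- Sylow's theorem inside a subgroup `A` containing a Sylow subgroup `P` of the whole group. -/
theorem exists_conj_mem {P A Q : Subgroup G} (hP : IsPGroup p P) (hidx : ¬ p ∣ P.index)
    (hPA : P ≤ A) (hQ : IsPGroup p Q) (hQA : Q ≤ A) : ∃ a ∈ A, ∀ q ∈ Q, a * q * a⁻¹ ∈ P := by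
  let S : Sylow p A := (hP.toSylow hidx).subtype hPA
  have hQ' : IsPGroup p (Q.subgroupOf A) := hQ.comap_subtype
  obtain ⟨R, hR⟩ := hQ'.exists_le_sylow
  obtain ⟨a, ha⟩ := MulAction.exists_smul_eq A R S
  refine ⟨a, a.2, fun q hq => ?_⟩
  have h1 : (⟨q, hQA hq⟩ : A) ∈ R := hR (Subgroup.mem_subgroupOf.2 hq)
  have h2 : a * ⟨q, hQA hq⟩ * a⁻¹ ∈ S := by
    rw [← ha, ← SetLike.mem_coe, Sylow.coe_smul]
    exact ⟨_, h1, rfl⟩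
  exact Subgroup.mem_subgroupOf.1 h2

/-- If `P` is a self-normalizing Sylow subgroup of the stabilizer of `y`, then the stabilizers in
`P` of the other points of the orbit of `y` are not picky. -/
theorem not_isPicky_of_smul_eq {P : Subgroup G} (hP : IsPGroup p P) (hidx : ¬ p ∣ P.index)
    (hN : Subgroup.normalizer (P : Set G) = P) {Y : Type*} [MulAction G Y] {y z : Y}
    (hy : ∀ x ∈ P, x • y = y) (hz : z ∈ MulAction.orbit G y) (hne : z ≠ y) {Q : Subgroup P}
    (hQ : ∀ q ∈ Q, (q : G) • z = z) : ¬ IsPicky P Q := by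
  obtain ⟨g, rfl⟩ := hz
  change g • y ≠ y at hne
  replace hQ : ∀ q ∈ Q, (q : G) • g • y = g • y := hQ
  intro hpicky
  -- The conjugate g⁻¹Qg fixes y, so some a fixing y conjugates it into P. Thus Q ≤ P^(ag⁻¹), and if
  -- Q were picky, ag⁻¹ would lie in N_G(P) = P and fix y, forcing g to fix y.
  let Q' : Subgroup G := (Q.map P.subtype).map (MulAut.conj g⁻¹).toMonoidHom
  have hQ' : IsPGroup p Q' := ((hP.to_subgroup Q).map P.subtype).map _
  obtain ⟨a, ha, haQ⟩ := exists_conj_mem (A := MulAction.stabilizer G y) hP hidx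
    (fun x hx => hy x hx) hQ' (by
      rintro _ ⟨_, ⟨q, hq, rfl⟩, rfl⟩
      have := hQ q hq
      rw [MulAction.mem_stabilizer_iff]
      simp [mul_smul, this])
  have hconj := hpicky (a * g⁻¹) (by
    rintro _ ⟨q, hq, rfl⟩
    rw [mem_conjBy]
    have := haQ _ ⟨_, ⟨q, hq, rfl⟩, rfl⟩
    simpa [mul_assoc] using this)
  rw [conjBy_eq_iff, hN] at hconj
  apply hne
  have h1 := hy _ hconj
  rw [MulAction.mem_stabilizer_iff] at ha
  rw [mul_smul] at h1
  have h2 : g⁻¹ • y = y := by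
    have h3 := congrArg (fun w => a⁻¹ • w) h1
    simp only [inv_smul_smul] at h3
    rw [h3, inv_smul_eq_iff, ha]
  rw [← h2, smul_inv_smul, h2]

theorem isPicky_top (P : Subgroup G) : IsPicky P ⊤ := by
  intro g hg
  rw [← MonoidHom.range_eq_map, Subgroup.range_subtype] at hg
  exact conjBy_eq_iff.2 (mem_normalizer_of_conj_mem fun x hx => mem_conjBy.1 (hg hx))

/-- A second P-fixed point would make P itself non-picky. For orbits of characters of N this pins
down the restriction to N of any linear constituent. -/
theorem eq_of_smul_eq_of_mem_orbit {P : Subgroup G} (hP : IsPGroup p P) (hidx : ¬ p ∣ P.index)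
    (hN : Subgroup.normalizer (P : Set G) = P) {Y : Type*} [MulAction G Y] {y z : Y}
    (hy : ∀ x ∈ P, x • y = y) (hz : z ∈ MulAction.orbit G y) (hz' : ∀ x ∈ P, x • z = z) :
    z = y := by
  by_contra hne
  exact not_isPicky_of_smul_eq hP hidx hN hy hz hne (Q := ⊤) (fun q _ => hz' q q.2) (isPicky_top P)

/-- Frattini argument: if f(g) normalizes f(P), then P and gPg⁻¹ both lie in the preimage of f(P),
so some a there brings gPg⁻¹ back to P, and ag ∈ N_G(P) = P. -/
theorem normalizer_map_eq {P : Subgroup G} (hP : IsPGroup p P) (hidx : ¬ p ∣ P.index)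
    (hN : Subgroup.normalizer (P : Set G) = P) {f : G →* H} (hf : Function.Surjective f) :
    Subgroup.normalizer (P.map f : Set H) = P.map f := by
  refine le_antisymm (fun h hh => ?_) Subgroup.le_normalizer
  obtain ⟨g, rfl⟩ := hf h
  obtain ⟨a, ha, haP⟩ := exists_conj_mem (A := (P.map f).comap f)
    (Q := P.map (MulAut.conj g).toMonoidHom) hP hidx (Subgroup.le_comap_map f P) (hP.map _) (by
      rintro _ ⟨x, hx, rfl⟩
      rw [Subgroup.mem_comap]
      have := (Subgroup.mem_normalizer_iff.1 hh (f x)).1 (Subgroup.mem_map_of_mem f hx)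
      simpa using this)
  have hag : a * g ∈ P := by
    rw [← SetLike.mem_coe, ← hN]
    exact mem_normalizer_of_conj_mem fun x hx => by
      simpa [mul_assoc] using haP _ ⟨x, hx, rfl⟩
  have h1 : f (a * g) ∈ P.map f := Subgroup.mem_map_of_mem f hag
  rw [map_mul] at h1
  exact (Subgroup.mul_mem_cancel_left (P.map f) (Subgroup.mem_comap.1 ha)).1 h1

/-- A lift g of an element witnessing failure downstairs becomes a witness upstairs after
multiplying by a suitable a in the preimage of f(P), again by Sylow's theorem in that preimage. -/
theorem not_isPicky_comap {P : Subgroup G} (hP : IsPGroup p P) (hidx : ¬ p ∣ P.index)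
    {f : G →* H} (hf : Function.Surjective f) {Q : Subgroup (P.map f)}
    (hQ : ¬ IsPicky (P.map f) Q) : ¬ IsPicky P (Q.comap (f.subgroupMap P)) := by
  intro hpicky
  apply hQ
  intro h hh
  obtain ⟨g, rfl⟩ := hf h
  obtain ⟨a, ha, haP⟩ := exists_conj_mem (A := (P.map f).comap f)
    (Q := ((Q.comap (f.subgroupMap P)).map P.subtype).map (MulAut.conj g).toMonoidHom) hP hidx
    (Subgroup.le_comap_map f P) (((hP.to_subgroup _).map _).map _) (by
      rintro _ ⟨_, ⟨q, hq, rfl⟩, rfl⟩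
      rw [Subgroup.mem_comap]
      have := mem_conjBy.1 (hh ⟨_, hq, rfl⟩)
      simpa using this)
  have hag := hpicky (a * g) (by
    rintro _ ⟨q, hq, rfl⟩
    rw [mem_conjBy]
    simpa [mul_assoc] using haP _ ⟨_, ⟨q, hq, rfl⟩, rfl⟩)
  rw [conjBy_eq_iff] at hag ⊢
  have h1 : f (a * g) ∈ Subgroup.normalizer (P.map f : Set H) := by
    refine mem_normalizer_of_conj_mem ?_
    rintro _ ⟨x, hx, rfl⟩
    rw [← map_inv, ← map_mul, ← map_mul]
    exact Subgroup.mem_map_of_mem f ((Subgroup.mem_normalizer_iff.1 hag x).1 hx)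
  rw [map_mul] at h1
  exact (Subgroup.mul_mem_cancel_left (Subgroup.normalizer (P.map f : Set H))
    (Subgroup.le_normalizer (Subgroup.mem_comap.1 ha))).1 h1

theorem not_isPicky_subgroupOf {P T : Subgroup G} (hPT : P ≤ T)
    {Q : Subgroup (P.subgroupOf T)} (hQ : ¬ IsPicky (P.subgroupOf T) Q) :
    ¬ IsPicky P (Q.comap (Subgroup.subgroupOfEquivOfLe hPT).symm.toMonoidHom) := by
  intro hpicky
  apply hQ
  intro t ht
  have h1 := hpicky t (by
    rintro _ ⟨q, hq, rfl⟩
    have := mem_conjBy.1 (ht ⟨_, hq, rfl⟩)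
    rw [mem_conjBy]
    exact Subgroup.mem_subgroupOf.1 this)
  ext x
  rw [mem_conjBy, Subgroup.mem_subgroupOf, Subgroup.mem_subgroupOf]
  have := SetLike.ext_iff.1 h1 (x : G)
  rw [mem_conjBy] at this
  exact this

end Sylow

/-! ### Twisting by linear characters -/

section Twist

variable {P : Type*} [Group P]

/-- Twisting a representation by a linear character. -/
def twist {V : Type*} [AddCommGroup V] [Module ℂ V] (ρ : Representation ℂ P V) (ν : P →* ℂˣ) :
    Representation ℂ P V where
  toFun g := (ν g : ℂ) • ρ g
  map_one' := by simp
  map_mul' g h := by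
    rw [map_mul, map_mul, Units.val_mul, smul_mul_smul_comm]

theorem twist_apply {V : Type*} [AddCommGroup V] [Module ℂ V] (ρ : Representation ℂ P V)
    (ν : P →* ℂˣ) (g : P) (v : V) : twist ρ ν g v = (ν g : ℂ) • ρ g v := rfl

theorem character_twist {V : Type*} [AddCommGroup V] [Module ℂ V] (ρ : Representation ℂ P V)
    (ν : P →* ℂˣ) (g : P) : (twist ρ ν).character g = (ν g : ℂ) * ρ.character g := by
  change LinearMap.trace ℂ V ((ν g : ℂ) • ρ g) = _
  rw [map_smul]
  rfl

theorem isIrreducible_twist {V : Type*} [AddCommGroup V] [Module ℂ V] {ρ : Representation ℂ P V}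
    (hρ : ρ.IsIrreducible) (ν : P →* ℂˣ) : (twist ρ ν).IsIrreducible := by
  rw [isIrreducible_iff] at hρ ⊢
  refine ⟨hρ.1, fun W hW => hρ.2 W fun g v hv => ?_⟩
  have := W.smul_mem ((ν g : ℂ)⁻¹) (hW g v hv)
  rwa [twist_apply, smul_smul, inv_mul_cancel₀ (Units.ne_zero _), one_smul] at this

theorem isWeightVector_twist {V : Type*} [AddCommGroup V] [Module ℂ V] {ρ : Representation ℂ P V}
    {ν : P →* ℂˣ} {v : V} (hv : IsWeightVector ρ ν v) (κ : P →* ℂˣ) :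
    IsWeightVector (twist ρ κ) (κ * ν) v :=
  ⟨hv.1, fun g => by rw [twist_apply, hv.2, smul_smul, MonoidHom.mul_apply, Units.val_mul]⟩

theorem IsCharacterOrZero.twist {f : P → ℂ} (hf : IsCharacterOrZero f) (ν : P →* ℂˣ) :
    IsCharacterOrZero (fun x => (ν x : ℂ) * f x) := by
  obtain ⟨n, ρ, rfl⟩ := hf
  exact ⟨n, EvseevPicky.twist ρ ν, funext fun g => (character_twist ρ ν g).symm⟩

end Twist

/-! ### Induced functions under surjections and twists -/

section Transport

variable {P R : Type*} [Group P] [Finite P] [Group R] [Finite R]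

theorem sum_comp_eq_card_ker_nsmul [Fintype P] [Fintype R] {φ : P →* R}
    (hφ : Function.Surjective φ) {A : Type*} [AddCommMonoid A] (F : R → A) :
    ∑ x, F (φ x) = Nat.card φ.ker • ∑ y, F y := by
  classical
  rw [Finset.sum_comp F φ, Finset.image_univ_of_surjective hφ, Finset.smul_sum]
  refine Finset.sum_congr rfl fun y _ => ?_
  congr 1
  rw [MonoidHom.card_fiber_eq_of_mem_range φ (hφ y) (hφ 1), ← Fintype.card_coe,
    ← Nat.card_eq_fintype_card]
  exact Nat.card_congr (Equiv.subtypeEquivRight fun x => by simp [MonoidHom.mem_ker])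

/-- Both the order of the subgroup and the sum over the group grow by the factor |ker φ|, which
cancels. -/
theorem ind_comap {φ : P →* R} (hφ : Function.Surjective φ) (Q : Subgroup R) (θ : Q → ℂ) (x : P) :
    ind (Q.comap φ) (fun q => θ ⟨φ q, q.2⟩) x = ind Q θ (φ x) := by
  classical
  have := Fintype.ofFinite P
  have := Fintype.ofFinite R
  let F : R → ℂ := fun r => if h : r ∈ Q then θ ⟨r, h⟩ else 0
  have hF : ∀ q : Q, F q = θ q := fun q => by simp [F]
  have hF0 : ∀ r ∉ Q, F r = 0 := fun r hr => by simp [F, hr]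
  rw [ind_apply Q θ F hF hF0, ind_apply _ _ (fun x => F (φ x)) (fun q => hF ⟨φ q, q.2⟩)
    (fun x hx => hF0 _ hx)]
  simp_rw [map_mul, map_inv]
  rw [sum_comp_eq_card_ker_nsmul hφ (fun y => F (y⁻¹ * φ x * y))]
  have hcard : (Nat.card (Q.comap φ) : ℂ) = Nat.card φ.ker * Nat.card Q := by
    have h := sum_comp_eq_card_ker_nsmul hφ (fun y => if y ∈ Q then (1 : ℂ) else 0)
    rw [nsmul_eq_mul] at h
    simp only [Finset.sum_boole] at h
    have h1 : Nat.card (Q.comap φ) = (Finset.univ.filter fun x => φ x ∈ Q).card := by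
      rw [Nat.card_eq_fintype_card]
      exact Fintype.card_subtype _
    have h2 : Nat.card Q = (Finset.univ.filter fun y => y ∈ Q).card := by
      rw [Nat.card_eq_fintype_card]
      exact Fintype.card_subtype _
    rw [h1, h2, h]
  have hk : (Nat.card φ.ker : ℂ) ≠ 0 := by exact_mod_cast Nat.card_pos.ne'
  have hq : (Nat.card Q : ℂ) ≠ 0 := by exact_mod_cast Nat.card_pos.ne'
  rw [hcard, nsmul_eq_mul]
  field_simp

theorem IsCharacterOrZero.comp {f : R → ℂ} (hf : IsCharacterOrZero f) {P : Type*} [Group P]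
    (φ : P →* R) : IsCharacterOrZero (fun x => f (φ x)) := by
  obtain ⟨n, ρ, rfl⟩ := hf
  exact ⟨n, ρ.comp φ, rfl⟩

theorem ind_twist (Q : Subgroup P) (θ : Q → ℂ) (ν : P →* ℂˣ) (x : P) :
    ind Q (fun q => (ν q : ℂ) * θ q) x = (ν x : ℂ) * ind Q θ x := by
  classical
  have := Fintype.ofFinite P
  let F : P → ℂ := fun r => if h : r ∈ Q then θ ⟨r, h⟩ else 0
  have hF : ∀ q : Q, F q = θ q := fun q => by simp [F]
  have hF0 : ∀ r ∉ Q, F r = 0 := fun r hr => by simp [F, hr]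
  rw [ind_apply Q θ F hF hF0, ind_apply _ _ (fun x => (ν x : ℂ) * F x) (fun q => by rw [hF])
    (fun x hx => by rw [hF0 x hx, mul_zero]), mul_left_comm]
  congr 1
  rw [Finset.mul_sum]
  refine Finset.sum_congr rfl fun y _ => ?_
  congr 2
  rw [map_mul, map_mul, mul_comm, ← mul_assoc, ← map_mul]
  simp

theorem sumsIndNonPicky_comp {G H : Type*} [Group G] [Finite G] [Group H] [Finite H]
    {P : Subgroup G} {R : Subgroup H} {φ : P →* R} (hφ : Function.Surjective φ)
    (hpicky : ∀ Q : Subgroup R, ¬ IsPicky R Q → ¬ IsPicky P (Q.comap φ)) {Δ : R → ℂ}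
    (hΔ : Δ ∈ sumsIndNonPicky R) : (fun x => Δ (φ x)) ∈ sumsIndNonPicky P := by
  unfold sumsIndNonPicky at hΔ
  induction hΔ using AddSubmonoid.closure_induction with
  | mem f hf =>
    obtain ⟨Q, θ, hQ, hθ, rfl⟩ := hf
    refine AddSubmonoid.subset_closure ⟨Q.comap φ, _, hpicky Q hQ, ?_,
      funext fun x => (ind_comap hφ Q θ x).symm⟩
    exact hθ.comp ((φ.comp (Q.comap φ).subtype).codRestrict Q fun q => q.2)
  | zero => exact zero_mem _
  | add f g _ _ hf hg => exact add_mem hf hg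

theorem sumsIndNonPicky_twist {G : Type*} [Group G] [Finite G]
    {P : Subgroup G} (ν : P →* ℂˣ) {Δ : P → ℂ}
    (hΔ : Δ ∈ sumsIndNonPicky P) : (fun x => (ν x : ℂ) * Δ x) ∈ sumsIndNonPicky P := by
  unfold sumsIndNonPicky at hΔ
  induction hΔ using AddSubmonoid.closure_induction with
  | mem f hf =>
    obtain ⟨Q, θ, hQ, hθ, rfl⟩ := hf
    exact AddSubmonoid.subset_closure ⟨Q, _, hQ, hθ.twist (ν.comp Q.subtype),
      funext fun x => (ind_twist Q θ ν x).symm⟩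
  | zero =>
    simp only [Pi.zero_apply, mul_zero]
    exact zero_mem _
  | add f g _ _ hf hg =>
    simp only [Pi.add_apply, mul_add]
    exact add_mem hf hg

end Transport

/-! ### Normal p'-subgroups act trivially; extension of invariant characters -/

section Coprime

variable {p : ℕ} [Fact p.Prime] {G V : Type*} [Group G] [Finite G] [AddCommGroup V] [Module ℂ V]
  [FiniteDimensional ℂ V]

/-- The value is a sum of eigenvalues, which are roots of unity. -/
theorem isIntegral_character (ρ : Representation ℂ G V) (g : G) :
    IsIntegral ℤ (ρ.character g) := by
  rw [Representation.character, Module.End.trace_eq_sum_roots_charpoly_of_splits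
    (IsAlgClosed.splits _)]
  refine IsIntegral.multiset_sum fun c hc => ?_
  have hev : Module.End.HasEigenvalue (ρ g) c :=
    Module.End.hasEigenvalue_iff_isRoot_charpoly _ _ |>.2 (Polynomial.isRoot_of_mem_roots hc)
  obtain ⟨v, hv⟩ := (hev.pow (orderOf g)).exists_hasEigenvector
  have h := hv.apply_eq_smul
  rw [← map_pow, pow_orderOf_eq_one, map_one, Module.End.one_apply] at h
  have h1 : c ^ orderOf g = 1 := smul_left_injective ℂ hv.2 (by simpa using h.symm)
  exact IsIntegral.of_pow (orderOf_pos g) (h1 ▸ isIntegral_one)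

theorem dvd_of_eq_mul_of_isIntegral (hp : p ≠ 0) {n : ℕ} {r : ℂ} (hr : IsIntegral ℤ r)
    (h : (n : ℂ) = p * r) : p ∣ n := by
  have hp' : (p : ℂ) ≠ 0 := by exact_mod_cast hp
  have hrq : r = algebraMap ℚ ℂ ((n : ℚ) / p) := by
    rw [map_div₀, map_natCast, map_natCast, h]
    field_simp
  rw [hrq, isIntegral_algebraMap_iff (algebraMap ℚ ℂ).injective] at hr
  obtain ⟨y, hy⟩ := IsIntegrallyClosed.isIntegral_iff.1 hr
  have hp'' : (p : ℚ) ≠ 0 := by exact_mod_cast hp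
  rw [eq_div_iff hp''] at hy
  have : y * (p : ℤ) = n := by
    rw [eq_intCast] at hy
    exact_mod_cast hy
  exact_mod_cast Dvd.intro_left y this

/-- If `P` is a self-normalizing `p`-subgroup, then normal subgroups of order prime to `p` act
trivially on irreducible representations of dimension prime to `p`. -/
theorem apply_eq_one_of_coprime {P K : Subgroup G} [K.Normal] (hP : IsPGroup p P)
    (hN : Subgroup.normalizer (P : Set G) = P) (hK : (Nat.card K).Coprime p)
    {ρ : Representation ℂ G V} (hρ : ρ.IsIrreducible) (hV : ¬ p ∣ Module.finrank ℂ V)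
    {k : G} (hk : k ∈ K) : ρ k = 1 := by
  classical
  have hpp : p.Prime := Fact.out
  have := Fintype.ofFinite K
  let σ : Representation ℂ K V := ρ.comp K.subtype
  -- Without invariants, the character sums to zero over K. The P-orbits on K ∖ {1} then make the
  -- dimension divisible by p in the algebraic integers.
  have hinv : σ.invariants ≠ ⊥ := by
    intro hbot
    have hinvt : Invertible (Nat.card K : ℂ) :=
      invertibleOfNonzero (by exact_mod_cast Nat.card_pos.ne')
    have hsum := σ.card_inv_mul_sum_char_eq_finrank
    rw [hbot, finrank_bot, Nat.cast_zero, mul_eq_zero, or_iff_right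
      (inv_ne_zero (by exact_mod_cast Nat.card_pos.ne'))] at hsum
    let _ : MulAction P K :=
      MulAction.compHom K ((MulAut.conjNormal : G →* MulAut K).comp P.subtype)
    have hsmul : ∀ (g : P) (x : K), ((g • x : K) : G) = g * x * (g : G)⁻¹ := fun g x => rfl
    -- The value at 1 is replaced by 0 so that `f` vanishes at all P-fixed points: such a point
    -- centralizes P, so it lies in N_G(P) = P, and it has order prime to p.
    let f : K → integralClosure ℤ ℂ := fun x =>
      if x = 1 then 0 else ⟨ρ.character x, isIntegral_character ρ x⟩
    have hdvd : (p : integralClosure ℤ ℂ) ∣ ∑ x, f x := by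
      refine dvd_sum_of_eq_zero_of_fixed hP f (fun g x => ?_) (fun x hx => if_pos ?_)
      · have h1 : g • x = 1 ↔ x = 1 := by
          rw [← Subtype.coe_inj, hsmul, ← Subtype.coe_inj (a := x)]
          simp [mul_inv_eq_one]
        simp only [f, h1]
        split_ifs
        · rfl
        · refine Subtype.ext ?_
          change ρ.character ((g • x : K) : G) = ρ.character x
          rw [hsmul, Representation.char_conj]
      · have hxP : (x : G) ∈ P := by
          rw [← SetLike.mem_coe, ← hN]
          refine mem_normalizer_of_conj_mem fun y hy => ?_
          have h2 := hx ⟨y, hy⟩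
          rw [← Subtype.coe_inj, hsmul] at h2
          have h3 : (x : G) * y * (x : G)⁻¹ = y := by
            rw [mul_inv_eq_iff_eq_mul, ← mul_inv_eq_iff_eq_mul.1 h2]
          rwa [h3]
        obtain ⟨j, hj⟩ := hP ⟨x, hxP⟩
        have hj' : x ^ p ^ j = 1 := Subtype.ext (by simpa using congrArg Subtype.val hj)
        have h4 : orderOf x ∣ Nat.gcd (Nat.card K) (p ^ j) :=
          Nat.dvd_gcd (orderOf_dvd_natCard x) (orderOf_dvd_of_pow_eq_one hj')
        rw [Nat.Coprime.pow_right j hK, Nat.dvd_one, orderOf_eq_one_iff] at h4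
        exact h4
    obtain ⟨r, hr⟩ := hdvd
    have hr' := congrArg (algebraMap (integralClosure ℤ ℂ) ℂ) hr
    rw [map_sum, map_mul, map_natCast] at hr'
    have hf : ∀ x : K, algebraMap (integralClosure ℤ ℂ) ℂ (f x) =
        σ.character x - if x = 1 then (Module.finrank ℂ V : ℂ) else 0 := by
      intro x
      simp only [f]
      split_ifs with h
      · rw [h, Representation.char_one, map_zero, sub_self]
      · rw [sub_zero]
        rfl
    simp_rw [hf] at hr'
    rw [Finset.sum_sub_distrib, hsum, zero_sub, Finset.sum_ite_eq' , if_pos (Finset.mem_univ _),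
      neg_eq_iff_eq_neg, ← mul_neg] at hr'
    exact hV (dvd_of_eq_mul_of_isIntegral hpp.ne_zero r.2.neg hr')
  rw [isIrreducible_iff] at hρ
  have htop := (hρ.2 σ.invariants (fun g v hv k => by
    have h1 := hv (MulAut.conjNormal g⁻¹ k)
    change ρ k (ρ g v) = ρ g v
    change ρ (MulAut.conjNormal g⁻¹ k : K) v = v at h1
    conv_rhs => rw [← h1]
    rw [← Module.End.mul_apply, ← Module.End.mul_apply, ← map_mul, ← map_mul,
      MulAut.conjNormal_apply]
    congr 2
    group)).resolve_left hinv
  ext v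
  have : v ∈ σ.invariants := htop ▸ Submodule.mem_top
  exact this ⟨k, hk⟩

/-- A linear character through which a normal `p`-subgroup acts on a representation of dimension
prime to `p` extends to the whole group. -/
theorem exists_extension_of_weightSpace_eq_top {N : Subgroup G} [N.Normal] (hN : IsPGroup p N)
    {ρ : Representation ℂ G V} (hV : ¬ p ∣ Module.finrank ℂ V) {μ : N →* ℂˣ}
    (hμ : weightSpace ρ μ = ⊤) : ∃ κ : G →* ℂˣ, ∀ n : N, κ n = μ n := by
  have hpp : p.Prime := Fact.out
  obtain ⟨k, hk⟩ := IsPGroup.iff_card.1 hN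
  set d := Module.finrank ℂ V
  have hcop : d.Coprime (p ^ k) := ((hpp.coprime_iff_not_dvd.2 hV).symm).pow_right k
  -- The determinant restricts to μ^d on N. As d is prime to |N| = p^k, a power of it with exponent
  -- inverse to d modulo p^k restricts to μ, and Euler's theorem supplies the exponent.
  let δ : G →* ℂˣ := MonoidHom.toHomUnits ((LinearMap.det : Module.End ℂ V →* ℂ).comp ρ)
  have hδ : ∀ n : N, δ n = μ n ^ d := by
    intro n
    ext
    have h1 : ρ n = (μ n : ℂ) • (1 : Module.End ℂ V) := by
      ext v
      have : v ∈ weightSpace ρ μ := hμ ▸ Submodule.mem_top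
      exact this n
    change LinearMap.det (ρ n) = _
    rw [h1, LinearMap.det_smul, map_one, mul_one, Units.val_pow_eq_pow_val]
  refine ⟨δ ^ (d ^ (Nat.totient (p ^ k) - 1)), fun n => ?_⟩
  rw [MonoidHom.pow_apply, hδ, ← pow_mul, ← pow_succ',
    Nat.sub_add_cancel (Nat.totient_pos.2 (pow_pos hpp.pos k))]
  have h1 : orderOf (μ n) ∣ p ^ k := by
    rw [orderOf_dvd_iff_pow_eq_one, ← map_pow, ← hk, pow_card_eq_one', map_one]
  have h2 := (pow_eq_pow_iff_modEq (x := μ n)).2 ((Nat.ModEq.pow_totient hcop).of_dvd h1)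
  rwa [pow_one] at h2

end Coprime

/-! ### The inductive property, under inflation, twisting and Clifford correspondence -/

section LinearConstituent

variable {p : ℕ} [Fact p.Prime] {G H : Type*} [Group G] [Finite G] [Group H] [Finite H]

/-- The restriction of `ρ` to `P` has a unique linear constituent `lam`, and the character of the
restriction is `lam` plus a sum of characters induced from non-picky subgroups. -/
def HasUniqueLinearConstituent (P : Subgroup G) {V : Type*} [AddCommGroup V] [Module ℂ V]
    (ρ : Representation ℂ G V) : Prop :=
  ∃ lam : P →* ℂˣ, (∃ v, IsWeightVector (ρ.comp P.subtype) lam v) ∧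
    (∀ ν v, IsWeightVector (ρ.comp P.subtype) ν v → ν = lam) ∧
    ∃ Δ ∈ sumsIndNonPicky P, ∀ x : P, ρ.character x = lam x + Δ x

variable {V V' : Type*} [AddCommGroup V] [Module ℂ V] [AddCommGroup V'] [Module ℂ V']

theorem exists_isWeightVector_map {f : G →* H} {P : Subgroup G} {ρ : Representation ℂ H V}
    {ν : P →* ℂˣ} {v : V}
    (hv : IsWeightVector ((ρ.comp f : Representation ℂ G V).comp P.subtype) ν v) :
    ∃ ν' : P.map f →* ℂˣ, IsWeightVector (ρ.comp (P.map f).subtype) ν' v ∧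
      ν = ν'.comp (f.subgroupMap P) := by
  obtain ⟨ν', hν'⟩ := exists_isWeightVector (ρ := (ρ.comp (P.map f).subtype :
    Representation ℂ (P.map f) V)) hv.1 (by
      rintro ⟨_, x, hx, rfl⟩
      exact ⟨_, hv.2 ⟨x, hx⟩⟩)
  refine ⟨ν', hν', hv.ext (ν' := ν'.comp (f.subgroupMap P)) ⟨hv.1, fun x => ?_⟩⟩
  exact hν'.2 (f.subgroupMap P x)

theorem HasUniqueLinearConstituent.comp {f : G →* H} (hf : Function.Surjective f)
    {P : Subgroup G} (hP : IsPGroup p P) (hidx : ¬ p ∣ P.index) {ρ : Representation ℂ H V}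
    (h : HasUniqueLinearConstituent (P.map f) ρ) :
    HasUniqueLinearConstituent P (ρ.comp f : Representation ℂ G V) := by
  obtain ⟨lam, ⟨v, hv⟩, huniq, Δ, hΔ, hχ⟩ := h
  refine ⟨lam.comp (f.subgroupMap P), ⟨v, hv.1, fun x => hv.2 (f.subgroupMap P x)⟩, ?_,
    fun x => Δ (f.subgroupMap P x),
    sumsIndNonPicky_comp (f.subgroupMap_surjective P) (fun Q hQ => not_isPicky_comap hP hidx hf hQ)
      hΔ, fun x => hχ (f.subgroupMap P x)⟩
  intro ν w hw
  obtain ⟨ν', hν', rfl⟩ := exists_isWeightVector_map hw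
  rw [huniq ν' w hν']

theorem HasUniqueLinearConstituent.twist {P : Subgroup G} {ρ : Representation ℂ G V}
    (h : HasUniqueLinearConstituent P ρ) (κ : G →* ℂˣ) :
    HasUniqueLinearConstituent P (twist ρ κ) := by
  obtain ⟨lam, ⟨v, hv⟩, huniq, Δ, hΔ, hχ⟩ := h
  refine ⟨κ.comp P.subtype * lam, ⟨v, isWeightVector_twist hv (κ.comp P.subtype)⟩, ?_,
    _, sumsIndNonPicky_twist (κ.comp P.subtype) hΔ, fun x => ?_⟩
  · intro ν w hw
    have h1 : IsWeightVector (ρ.comp P.subtype) ((κ.comp P.subtype)⁻¹ * ν) w := by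
      refine ⟨hw.1, fun x => ?_⟩
      have h2 := hw.2 x
      change (κ x : ℂ) • ρ x w = _ at h2
      change ρ x w = ((((κ x)⁻¹ * ν x : ℂˣ)) : ℂ) • w
      rw [Units.val_mul, ← smul_smul, ← h2, smul_smul, ← Units.val_mul, inv_mul_cancel,
        Units.val_one, one_smul]
    rw [← huniq _ _ h1]
    ext x
    simp
  · rw [character_twist, hχ, mul_add]
    simp

theorem twist_inv_twist (ρ : Representation ℂ G V) (κ : G →* ℂˣ) :
    EvseevPicky.twist (EvseevPicky.twist ρ κ⁻¹) κ = ρ := by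
  ext g v
  rw [twist_apply, twist_apply, smul_smul, ← Units.val_mul]
  simp

section Clifford

variable {N : Subgroup G} [N.Normal]

/-- A linear character of P is constant on P-conjugacy classes. -/
theorem smul_eq_of_isWeightVector {P : Subgroup G} (hNP : N ≤ P) {ν : P →* ℂˣ} {x : G}
    (hx : x ∈ P) : x • ν.comp (Subgroup.inclusion hNP) = ν.comp (Subgroup.inclusion hNP) := by
  ext n
  rw [conj_smul_apply]
  have : (Subgroup.inclusion hNP) (MulAut.conjNormal x⁻¹ n) =
      (⟨x, hx⟩ : P)⁻¹ * Subgroup.inclusion hNP n * ⟨x, hx⟩ := by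
    ext
    simp
  rw [MonoidHom.comp_apply, this, map_mul, map_mul, map_inv, mul_comm, mul_inv_cancel_left,
    MonoidHom.comp_apply]

theorem mem_weightSpace_of_isWeightVector {P : Subgroup G} (hNP : N ≤ P) {ν : P →* ℂˣ}
    {ρ : Representation ℂ G V} {v : V} (hv : IsWeightVector (ρ.comp P.subtype) ν v) :
    v ∈ weightSpace ρ (ν.comp (Subgroup.inclusion hNP)) :=
  fun n => hv.2 (Subgroup.inclusion hNP n)

theorem weightSpace_ne_bot_of_isWeightVector {P : Subgroup G} (hNP : N ≤ P) {ν : P →* ℂˣ}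
    {ρ : Representation ℂ G V} {v : V} (hv : IsWeightVector (ρ.comp P.subtype) ν v) :
    weightSpace ρ (ν.comp (Subgroup.inclusion hNP)) ≠ ⊥ := fun h =>
  hv.1 (by simpa [h] using mem_weightSpace_of_isWeightVector hNP hv)

/-- The representation of the stabilizer of `μ` on the weight space of `μ`. -/
abbrev stabRep (ρ : Representation ℂ G V) (μ : N →* ℂˣ) :
    Representation ℂ (MulAction.stabilizer G μ) (weightSpace ρ μ) :=
  weightRep ρ μ (MulAction.stabilizer G μ).subtype fun h => h.2

theorem character_stabRep [Fintype N] [FiniteDimensional ℂ V] (ρ : Representation ℂ G V)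
    (μ : N →* ℂˣ) (t : MulAction.stabilizer G μ) :
    (stabRep ρ μ).character t = LinearMap.trace ℂ V (ρ t * weightProj ρ μ) :=
  character_weightRep ρ μ (MulAction.stabilizer G μ).subtype (fun h => h.2) t

theorem weightProj_eq_zero [Fintype N] {ρ : Representation ℂ G V} {μ : N →* ℂˣ}
    (h : weightSpace ρ μ = ⊥) : weightProj ρ μ = 0 := by
  ext v
  simpa [h] using weightProj_mem ρ μ v

theorem isWeightVector_stabRep {P : Subgroup G} {ρ : Representation ℂ G V} {μ : N →* ℂˣ}
    (hPμ : P ≤ MulAction.stabilizer G μ) {ν : P →* ℂˣ} {v : V}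
    (hv : IsWeightVector (ρ.comp P.subtype) ν v) (hvμ : v ∈ weightSpace ρ μ) :
    IsWeightVector ((stabRep ρ μ).comp (P.subgroupOf (MulAction.stabilizer G μ)).subtype)
      (ν.comp (Subgroup.subgroupOfEquivOfLe hPμ).toMonoidHom) (⟨v, hvμ⟩ : weightSpace ρ μ) :=
  ⟨fun h => hv.1 (congrArg Subtype.val h),
    fun x => Subtype.ext (hv.2 (Subgroup.subgroupOfEquivOfLe hPμ x))⟩

/-- The μ-space supplies the linear constituent and part of the remainder; the other weight spaces,
grouped in P-orbits, give characters induced from non-picky stabilizers. Any linear constituent of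
the restriction to P lives in a P-invariant weight space, hence in that of μ. -/
theorem HasUniqueLinearConstituent.of_stabRep [FiniteDimensional ℂ V] {P : Subgroup G}
    (hP : IsPGroup p P) (hidx : ¬ p ∣ P.index) (hPN : Subgroup.normalizer (P : Set G) = P)
    (hNP : N ≤ P) {ρ : Representation ℂ G V} (hρ : ρ.IsIrreducible) {μ : N →* ℂˣ}
    (hμ : weightSpace ρ μ ≠ ⊥) (hPμ : P ≤ MulAction.stabilizer G μ)
    (h : HasUniqueLinearConstituent (P.subgroupOf (MulAction.stabilizer G μ)) (stabRep ρ μ)) :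
    HasUniqueLinearConstituent P ρ := by
  classical
  have := Fintype.ofFinite N
  have := Fintype.ofFinite (N →* ℂˣ)
  obtain ⟨lam, ⟨v, hv⟩, huniq, Δ, hΔ, hχ⟩ := h
  let e := Subgroup.subgroupOfEquivOfLe hPμ
  -- The block of μ is set to zero here because the stabilizer's representation already accounts for
  -- it.
  let c : P → (N →* ℂˣ) → ℂ := fun x b =>
    if b = μ then 0 else LinearMap.trace ℂ V (ρ x * weightProj ρ b)
  refine ⟨lam.comp e.symm.toMonoidHom, ⟨v, fun h => hv.1 (Subtype.ext h),
    fun x => congrArg Subtype.val (hv.2 (e.symm x))⟩, ?_,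
    (fun x => Δ (e.symm.toMonoidHom x)) + (fun x => ∑ b, c x b),
    add_mem (sumsIndNonPicky_comp e.symm.surjective
      (fun Q hQ => not_isPicky_subgroupOf hPμ hQ) hΔ)
    (sum_mem_of_ind_stabilizer_mem c ?_ ?_ _ ?_), fun x => ?_⟩
  · intro ν w hw
    have h1 : ν.comp (Subgroup.inclusion hNP) = μ :=
      eq_of_smul_eq_of_mem_orbit hP hidx hPN (fun x hx => hPμ hx)
        (mem_orbit_of_weightSpace_ne_bot hρ hμ (weightSpace_ne_bot_of_isWeightVector hNP hw))
        (fun x hx => smul_eq_of_isWeightVector hNP hx)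
    have h2 : w ∈ weightSpace ρ μ := h1 ▸ mem_weightSpace_of_isWeightVector hNP hw
    rw [← huniq _ _ (isWeightVector_stabRep hPμ hw h2)]
    ext x
    simp [e]
  · intro x b hb
    simp only [c]
    split_ifs
    · rfl
    · exact trace_eq_zero_of_smul_ne ρ hb
  · intro g x b
    have hb : g • b = μ ↔ b = μ := by
      have hg : (g : G) • μ = μ := hPμ g.2
      constructor
      · intro h
        rw [← hg] at h
        exact (MulAction.injective (g : G)) h
      · rintro rfl
        exact hg
    simp only [c, hb]
    split_ifs
    · rfl
    · exact trace_conj_weightProj ρ b g x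
  · intro b
    by_cases hb : b = μ ∨ weightSpace ρ b = ⊥
    · have h0 : (fun q : MulAction.stabilizer P b => c q b) = 0 := by
        ext q
        rcases hb with hb | hb
        · simp [c, hb]
        · simp [c, weightProj_eq_zero hb]
      have h1 : ind (MulAction.stabilizer P b) (0 : MulAction.stabilizer P b → ℂ) = 0 := by
        ext x
        simp [ind]
      rw [h0, h1]
      exact zero_mem _
    · push Not at hb
      refine AddSubmonoid.subset_closure ⟨MulAction.stabilizer P b, _, ?_, ?_, rfl⟩
      · exact not_isPicky_of_smul_eq hP hidx hPN (fun x hx => hPμ hx)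
          (mem_orbit_of_weightSpace_ne_bot hρ hμ hb.2) hb.1 (fun q hq => hq)
      · have h1 : (fun q : MulAction.stabilizer P b => c q b) =
            (weightRep ρ b (P.subtype.comp (MulAction.stabilizer P b).subtype)
              fun q => q.2).character := by
          ext q
          refine (if_neg hb.1).trans (Eq.symm ?_)
          exact character_weightRep ρ b (P.subtype.comp (MulAction.stabilizer P b).subtype)
            (fun q => q.2) q
        rw [h1]
        exact isCharacterOrZero_character _
  · rw [character_eq_sum_trace hρ hμ, ← Finset.sum_erase_add _ _ (Finset.mem_univ μ)]
    have h1 : ∑ b, c x b =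
        ∑ b ∈ Finset.univ.erase μ, LinearMap.trace ℂ V (ρ x * weightProj ρ b) := by
      rw [← Finset.sum_erase_add _ _ (Finset.mem_univ μ)]
      simp only [c, if_true, add_zero]
      exact Finset.sum_congr rfl fun b hb => if_neg (Finset.ne_of_mem_erase hb)
    have h2 := hχ (e.symm x)
    rw [character_stabRep] at h2
    change LinearMap.trace ℂ V (ρ x * weightProj ρ μ) = _ at h2
    rw [h2, Pi.add_apply, h1]
    simp only [MonoidHom.comp_apply, MulEquiv.toMonoidHom_eq_coe, MonoidHom.coe_coe]
    ring

/-- Injectivity of the Clifford correspondence: the trace of x on the block of b is zero if x moves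
b or b lies outside the orbit of μ, and otherwise conjugation carries it to a character value of the
stabilizer on the μ-space. -/
theorem character_eq_of_stabRep [FiniteDimensional ℂ V] [FiniteDimensional ℂ V']
    {ρ : Representation ℂ G V} (hρ : ρ.IsIrreducible) {ρ' : Representation ℂ G V'}
    (hρ' : ρ'.IsIrreducible) {μ : N →* ℂˣ} (hμ : weightSpace ρ μ ≠ ⊥)
    (hμ' : weightSpace ρ' μ ≠ ⊥) (h : (stabRep ρ μ).character = (stabRep ρ' μ).character) :
    ρ.character = ρ'.character := by
  classical
  have := Fintype.ofFinite N
  have := Fintype.ofFinite (N →* ℂˣ)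
  ext x
  rw [character_eq_sum_trace hρ hμ, character_eq_sum_trace hρ' hμ']
  refine Finset.sum_congr rfl fun b _ => ?_
  by_cases hxb : x • b = b
  · by_cases hb : b ∈ MulAction.orbit G μ
    · obtain ⟨g, rfl⟩ := hb
      change x • g • μ = g • μ at hxb
      have hx : x = g * (g⁻¹ * x * g) * g⁻¹ := by group
      change LinearMap.trace ℂ V (ρ x * weightProj ρ (g • μ)) =
        LinearMap.trace ℂ V' (ρ' x * weightProj ρ' (g • μ))
      rw [hx, trace_conj_weightProj, trace_conj_weightProj]
      have h1 := congrFun h ⟨g⁻¹ * x * g, by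
        rw [MulAction.mem_stabilizer_iff, mul_smul, mul_smul, hxb, inv_smul_smul]⟩
      rwa [character_stabRep, character_stabRep] at h1
    · have h0 : weightSpace ρ b = ⊥ := by
        by_contra h2
        exact hb (mem_orbit_of_weightSpace_ne_bot hρ hμ h2)
      have h0' : weightSpace ρ' b = ⊥ := by
        by_contra h2
        exact hb (mem_orbit_of_weightSpace_ne_bot hρ' hμ' h2)
      rw [weightProj_eq_zero h0, weightProj_eq_zero h0', mul_zero, mul_zero, map_zero, map_zero]
  · rw [trace_eq_zero_of_smul_ne ρ hxb, trace_eq_zero_of_smul_ne ρ' hxb]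

end Clifford

end LinearConstituent

/-! ### Descent to quotients and stabilizers -/

section Quotient

variable {G H V : Type*} [Group G] [Group H] [AddCommGroup V] [Module ℂ V]

theorem isIrreducible_of_comp {f : G →* H} {ρ : Representation ℂ H V}
    (h : Representation.IsIrreducible (ρ.comp f : Representation ℂ G V)) : ρ.IsIrreducible := by
  rw [isIrreducible_iff] at h ⊢
  exact ⟨h.1, fun W hW => h.2 W fun g v hv => hW (f g) v hv⟩

theorem exists_eq_comp_mk {K : Subgroup G} [K.Normal] {ρ : Representation ℂ G V}
    (h : ∀ k ∈ K, ρ k = 1) :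
    ∃ ρ' : Representation ℂ (G ⧸ K) V, ρ = ρ'.comp (QuotientGroup.mk' K) :=
  ⟨QuotientGroup.lift K ρ fun k hk => h k hk, by ext g v; rfl⟩

theorem card_quotient_lt_of_ne_bot [Finite G] {K : Subgroup G} (hK : K ≠ ⊥) :
    Nat.card (G ⧸ K) < Nat.card G := by
  rw [Subgroup.card_eq_card_quotient_mul_card_subgroup K]
  exact lt_mul_of_one_lt_right Nat.card_pos ((Subgroup.one_lt_card_iff_ne_bot K).2 hK)

theorem card_lt_of_ne_top [Finite G] {T : Subgroup G} (hT : T ≠ ⊤) :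
    Nat.card T < Nat.card G :=
  lt_of_le_of_ne (Subgroup.card_le_card_group T) fun h => hT (Subgroup.card_eq_iff_eq_top T |>.1 h)

theorem normalizer_subgroupOf_eq [Finite G] {P T : Subgroup G}
    (hN : Subgroup.normalizer (P : Set G) = P) (hPT : P ≤ T) :
    Subgroup.normalizer (P.subgroupOf T : Set T) = P.subgroupOf T := by
  refine le_antisymm (fun t ht => ?_) Subgroup.le_normalizer
  rw [Subgroup.mem_subgroupOf, ← SetLike.mem_coe, ← hN]
  refine mem_normalizer_of_conj_mem fun x hx => ?_
  exact Subgroup.mem_subgroupOf.1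
    ((Subgroup.mem_normalizer_iff.1 ht ⟨x, hPT hx⟩).1 (Subgroup.mem_subgroupOf.2 hx))

theorem weightSpace_eq_top {N : Subgroup G} [N.Normal] {ρ : Representation ℂ G V}
    (hρ : ρ.IsIrreducible) {μ : N →* ℂˣ} (hμ : weightSpace ρ μ ≠ ⊥)
    (hT : MulAction.stabilizer G μ = ⊤) : weightSpace ρ μ = ⊤ := by
  rw [isIrreducible_iff] at hρ
  refine (hρ.2 _ fun g v hv => ?_).resolve_left hμ
  have hg : g ∈ MulAction.stabilizer G μ := hT ▸ Subgroup.mem_top g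
  have := map_mem_weightSpace hv g
  rwa [MulAction.mem_stabilizer_iff.1 hg] at this

theorem twist_inv_eq_one {N : Subgroup G} {ρ : Representation ℂ G V} {μ : N →* ℂˣ}
    (hμ : weightSpace ρ μ = ⊤) {κ : G →* ℂˣ} (hκ : ∀ n : N, κ n = μ n) :
    ∀ n ∈ N, twist ρ κ⁻¹ n = 1 := by
  intro n hn
  ext v
  have hv : v ∈ weightSpace ρ μ := hμ ▸ Submodule.mem_top
  have h1 := hv ⟨n, hn⟩
  change ρ n v = _ at h1
  rw [twist_apply, h1, ← hκ, smul_smul, ← Units.val_mul]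
  simp

end Quotient

/-- For a self-normalizing Sylow `p`-subgroup `P` of a `p`-solvable group, every irreducible
representation of dimension prime to `p` restricts to `P` with a unique linear constituent, up to
induction from non-picky subgroups, and is determined by this constituent. -/
theorem IsPSolvable.hasUniqueLinearConstituent {p : ℕ} [Fact p.Prime] {G : Type u} [Group G]
    [Finite G] (hG : IsPSolvable p G) {P : Subgroup G} (hP : IsPGroup p P)
    (hidx : ¬ p ∣ P.index) (hPN : Subgroup.normalizer (P : Set G) = P) :
    (∀ (V : Type) [AddCommGroup V] [Module ℂ V] [FiniteDimensional ℂ V]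
      (ρ : Representation ℂ G V), ρ.IsIrreducible → ¬ p ∣ Module.finrank ℂ V →
        HasUniqueLinearConstituent P ρ) ∧
    (∀ (V V' : Type) [AddCommGroup V] [Module ℂ V] [FiniteDimensional ℂ V] [AddCommGroup V']
      [Module ℂ V'] [FiniteDimensional ℂ V'] (ρ : Representation ℂ G V)
      (ρ' : Representation ℂ G V'), ρ.IsIrreducible → ρ'.IsIrreducible →
        ¬ p ∣ Module.finrank ℂ V → ¬ p ∣ Module.finrank ℂ V' → ∀ (ν : P →* ℂˣ) (v : V) (v' : V'),
          IsWeightVector (ρ.comp P.subtype) ν v → IsWeightVector (ρ'.comp P.subtype) ν v' →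
            ρ.character = ρ'.character) := by
  induction hn : Nat.card G using Nat.strong_induction_on generalizing G with
  | _ n ih =>
  subst hn
  rcases subsingleton_or_nontrivial G with hsub | hnt
  · have h1 : ∀ (V : Type) [AddCommGroup V] [Module ℂ V] [FiniteDimensional ℂ V]
        (ρ : Representation ℂ G V), ρ.IsIrreducible →
          (∃ v : V, v ≠ 0) ∧ ∀ g, ρ.character g = 1 := by
      intro V _ _ _ ρ hρ
      have := ((isIrreducible_iff ρ).1 hρ).1
      obtain ⟨v, hv⟩ := exists_ne (0 : V)
      have hw : IsWeightVector ρ 1 v := ⟨hv, fun g => by rw [Subsingleton.elim g 1]; simp⟩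
      refine ⟨⟨v, hv⟩, fun g => ?_⟩
      rw [character_eq_of_isWeightVector (finrank_eq_one_of_isWeightVector hρ hw) hw]
      simp
    refine ⟨fun V _ _ _ ρ hρ _ => ?_, fun V V' _ _ _ _ _ _ ρ ρ' hρ hρ' _ _ _ _ _ _ _ => ?_⟩
    · obtain ⟨⟨v, hv⟩, hχ⟩ := h1 V ρ hρ
      refine ⟨1, ⟨v, hv, fun g => ?_⟩, fun ν w _ => ?_, 0, zero_mem _, fun x => ?_⟩
      · rw [Subsingleton.elim g 1]
        simp
      · ext x
        rw [Subsingleton.elim x 1]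
        simp
      · simp [hχ]
    · ext g
      rw [(h1 V ρ hρ).2, (h1 V' ρ' hρ').2]
  · obtain ⟨N, hNn, hN1, hN⟩ := hG.exists_normal
    have hquot := ih _ (card_quotient_lt_of_ne_bot hN1)
      (hG.map (QuotientGroup.mk' N) (QuotientGroup.mk'_surjective N))
      (P := P.map (QuotientGroup.mk' N)) (hP.map _)
      (fun h => hidx (h.trans (P.index_map_dvd (QuotientGroup.mk'_surjective N))))
      (normalizer_map_eq hP hidx hPN (QuotientGroup.mk'_surjective N)) rfl
    have hquot1 : ∀ (V : Type) [AddCommGroup V] [Module ℂ V] [FiniteDimensional ℂ V]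
        (ρ : Representation ℂ G V), ρ.IsIrreducible → ¬ p ∣ Module.finrank ℂ V →
          (∀ k ∈ N, ρ k = 1) → HasUniqueLinearConstituent P ρ := by
      intro V _ _ _ ρ hρ hV htriv
      obtain ⟨ρ₁, rfl⟩ := exists_eq_comp_mk htriv
      exact (hquot.1 V ρ₁ (isIrreducible_of_comp hρ) hV).comp (QuotientGroup.mk'_surjective N)
        hP hidx
    have hquot2 : ∀ (V V' : Type) [AddCommGroup V] [Module ℂ V] [FiniteDimensional ℂ V]
        [AddCommGroup V'] [Module ℂ V'] [FiniteDimensional ℂ V'] (ρ : Representation ℂ G V)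
        (ρ' : Representation ℂ G V'), ρ.IsIrreducible → ρ'.IsIrreducible →
          ¬ p ∣ Module.finrank ℂ V → ¬ p ∣ Module.finrank ℂ V' →
          (∀ k ∈ N, ρ k = 1) → (∀ k ∈ N, ρ' k = 1) → ∀ (ν : P →* ℂˣ) (v : V) (v' : V'),
            IsWeightVector (ρ.comp P.subtype) ν v → IsWeightVector (ρ'.comp P.subtype) ν v' →
              ρ.character = ρ'.character := by
      intro V V' _ _ _ _ _ _ ρ ρ' hρ hρ' hV hV' htriv htriv' ν v v' hv hv'
      obtain ⟨ρ₁, rfl⟩ := exists_eq_comp_mk htriv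
      obtain ⟨ρ₂, rfl⟩ := exists_eq_comp_mk htriv'
      obtain ⟨ν₁, hν₁, h1⟩ := exists_isWeightVector_map hv
      obtain ⟨ν₂, hν₂, h2⟩ := exists_isWeightVector_map hv'
      have h12 : ν₁ = ν₂ := by
        refine DFunLike.ext _ _ fun y => ?_
        obtain ⟨x, rfl⟩ := (QuotientGroup.mk' N).subgroupMap_surjective P y
        exact DFunLike.congr_fun (h1.symm.trans h2) x
      subst h12
      have := hquot.2 V V' ρ₁ ρ₂ (isIrreducible_of_comp hρ) (isIrreducible_of_comp hρ') hV hV'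
        ν₁ v v' hν₁ hν₂
      ext g
      exact congrFun this (QuotientGroup.mk' N g)
    rcases hN with hN | hN
    · have hNP : N ≤ P := hN.le_sylow_of_normal (hP.toSylow hidx)
      have := Fintype.ofFinite N
      have hstab : ∀ μ : N →* ℂˣ, MulAction.stabilizer G μ ≠ ⊤ →
          P ≤ MulAction.stabilizer G μ → _ := fun μ hT hPμ =>
        ih _ (card_lt_of_ne_top hT) (hG.subgroup _)
          (P := P.subgroupOf (MulAction.stabilizer G μ)) hP.comap_subtype
          (fun h => hidx (h.trans (Subgroup.relIndex_dvd_index_of_le hPμ)))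
          (normalizer_subgroupOf_eq hPN hPμ) rfl
      constructor
      · intro V _ _ _ ρ hρ hV
        obtain ⟨ν, v, hv⟩ := IsPGroup.exists_isWeightVector hP
          (ρ.comp P.subtype : Representation ℂ P V) hV
        have hμ := weightSpace_ne_bot_of_isWeightVector hNP hv
        have hPμ : P ≤ MulAction.stabilizer G (ν.comp (Subgroup.inclusion hNP)) :=
          fun x hx => smul_eq_of_isWeightVector hNP hx
        by_cases hT : MulAction.stabilizer G (ν.comp (Subgroup.inclusion hNP)) = ⊤
        · have htop := weightSpace_eq_top hρ hμ hT
          obtain ⟨κ, hκ⟩ := exists_extension_of_weightSpace_eq_top hN hV htop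
          have h1 := (hquot1 V _ (isIrreducible_twist hρ κ⁻¹) hV
            (twist_inv_eq_one htop hκ)).twist κ
          rwa [twist_inv_twist] at h1
        · exact HasUniqueLinearConstituent.of_stabRep hP hidx hPN hNP hρ hμ hPμ
            ((hstab _ hT hPμ).1 _ _ (isIrreducible_weightRep hρ hμ)
              fun h => hV (h.trans (finrank_weightSpace_dvd hρ hμ)))
      · intro V V' _ _ _ _ _ _ ρ ρ' hρ hρ' hV hV' ν v v' hv hv'
        have hμ := weightSpace_ne_bot_of_isWeightVector hNP hv
        have hμ' := weightSpace_ne_bot_of_isWeightVector hNP hv'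
        have hPμ : P ≤ MulAction.stabilizer G (ν.comp (Subgroup.inclusion hNP)) :=
          fun x hx => smul_eq_of_isWeightVector hNP hx
        by_cases hT : MulAction.stabilizer G (ν.comp (Subgroup.inclusion hNP)) = ⊤
        · have htop := weightSpace_eq_top hρ hμ hT
          have htop' := weightSpace_eq_top hρ' hμ' hT
          obtain ⟨κ, hκ⟩ := exists_extension_of_weightSpace_eq_top hN hV htop
          have h1 := hquot2 V V' _ _ (isIrreducible_twist hρ κ⁻¹) (isIrreducible_twist hρ' κ⁻¹)
            hV hV' (twist_inv_eq_one htop hκ) (twist_inv_eq_one htop' hκ) _ v v'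
            (isWeightVector_twist hv (κ⁻¹.comp P.subtype))
            (isWeightVector_twist hv' (κ⁻¹.comp P.subtype))
          ext g
          have h2 := congrFun h1 g
          rw [character_twist, character_twist] at h2
          exact mul_left_cancel₀ (Units.ne_zero _) h2
        · exact character_eq_of_stabRep hρ hρ' hμ hμ' ((hstab _ hT hPμ).2 _ _ _ _
            (isIrreducible_weightRep hρ hμ) (isIrreducible_weightRep hρ' hμ')
            (fun h => hV (h.trans (finrank_weightSpace_dvd hρ hμ)))
            (fun h => hV' (h.trans (finrank_weightSpace_dvd hρ' hμ'))) _ _ _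
            (isWeightVector_stabRep hPμ hv (mem_weightSpace_of_isWeightVector hNP hv))
            (isWeightVector_stabRep hPμ hv' (mem_weightSpace_of_isWeightVector hNP hv')))
    -- Here N has order prime to p, so it acts trivially and everything factors through G/N.
    · exact ⟨fun V _ _ _ ρ hρ hV => hquot1 V ρ hρ hV fun k hk =>
          apply_eq_one_of_coprime hP hPN hN hρ hV hk,
        fun V V' _ _ _ _ _ _ ρ ρ' hρ hρ' hV hV' ν v v' hv hv' => hquot2 V V' ρ ρ' hρ hρ' hV hV'
          (fun k hk => apply_eq_one_of_coprime hP hPN hN hρ hV hk)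
          (fun k hk => apply_eq_one_of_coprime hP hPN hN hρ' hV' hk) ν v v' hv hv'⟩

/-! ### Surjectivity through induced representations -/

section Induced

variable {G : Type*} [Group G] [Finite G]

/-- Every linear character of a subgroup of index prime to `p` occurs in the restriction of an
irreducible representation of dimension prime to `p`. -/
theorem exists_irreducible_isWeightVector {p : ℕ} {P : Subgroup G} (hidx : ¬ p ∣ P.index)
    (ν : P →* ℂˣ) : ∃ (n : ℕ) (ρ : Representation ℂ G (Fin n → ℂ)), ρ.IsIrreducible ∧ ¬ p ∣ n ∧
      ∃ v, IsWeightVector (ρ.comp P.subtype) ν v := by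
  classical
  have := Fintype.ofFinite G
  have hPc : (Nat.card P : ℂ) ≠ 0 := by exact_mod_cast Nat.card_pos.ne'
  -- A model of the induced representation of ν, with G acting by right translation.
  let U : Submodule ℂ (G → ℂ) :=
    { carrier := {f | ∀ (x : P) (g : G), f (x * g) = ν x * f g}
      add_mem' := fun {f f'} hf hf' x g => by
        rw [Pi.add_apply, Pi.add_apply, hf, hf', mul_add]
      zero_mem' := fun x g => by simp
      smul_mem' := fun c f hf x g => by
        rw [Pi.smul_apply, Pi.smul_apply, hf, smul_eq_mul, smul_eq_mul, mul_left_comm] }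
  let R : Representation ℂ G (G → ℂ) :=
    { toFun := fun g => LinearMap.funLeft ℂ ℂ (fun h => h * g)
      map_one' := by
        ext
        simp [LinearMap.funLeft]
      map_mul' := fun a b => by
        ext
        simp [LinearMap.funLeft, mul_assoc] }
  have hR : ∀ g f h, R g f h = f (h * g) := fun g f h => rfl
  have hU : ∀ g, ∀ f ∈ U, R g f ∈ U := fun g f hf x h => by
    rw [hR, hR, mul_assoc, hf]
  -- Averaging over left translations by P projects onto U. Only x = 1 has nonzero trace, so dim U =
  -- |G : P|.
  let E : Module.End ℂ (G → ℂ) :=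
    (Nat.card P : ℂ)⁻¹ • ∑ x : P, ((ν x⁻¹ : ℂˣ) : ℂ) • LinearMap.funLeft ℂ ℂ (fun h => (x : G) * h)
  have hE : ∀ f g, E f g = (Nat.card P : ℂ)⁻¹ * ∑ x : P, ((ν x⁻¹ : ℂˣ) : ℂ) * f (x * g) := by
    intro f g
    simp [E, LinearMap.sum_apply, LinearMap.funLeft]
  have hproj : LinearMap.IsProj U E := by
    constructor
    · intro f y g
      rw [hE, hE, mul_left_comm]
      congr 1
      rw [Finset.mul_sum]
      refine Fintype.sum_equiv (Equiv.mulRight y) _ _ fun x => ?_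
      change _ = (ν y : ℂ) * (((ν (x * y)⁻¹ : ℂˣ) : ℂ) * f (((x * y : P) : G) * g))
      rw [← mul_assoc (ν y : ℂ), ← Units.val_mul, ← map_mul, Subgroup.coe_mul, mul_assoc (x : G)]
      simp
    · intro f hf
      ext g
      rw [hE]
      simp_rw [hf _ g, ← mul_assoc, ← Units.val_mul, ← map_mul]
      simp
  have htr : ∀ x : G, LinearMap.trace ℂ (G → ℂ) (LinearMap.funLeft ℂ ℂ (fun h => x * h)) =
      if x = 1 then (Nat.card G : ℂ) else 0 := by
    intro x
    rw [LinearMap.trace_eq_matrix_trace ℂ (Pi.basisFun ℂ G), Matrix.trace]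
    simp only [Matrix.diag_apply, LinearMap.toMatrix_apply, Pi.basisFun_apply, Pi.basisFun_repr,
      LinearMap.funLeft_apply, Pi.single_apply, mul_eq_right]
    split_ifs
    · simp
    · simp
  have hfin : Module.finrank ℂ U = P.index := by
    have h1 := hproj.trace
    rw [map_smul, map_sum] at h1
    simp only [map_smul, htr, smul_eq_mul, OneMemClass.coe_eq_one, mul_ite, mul_zero,
      Finset.sum_ite_eq', Finset.mem_univ, if_true, inv_one, map_one, Units.val_one, one_mul] at h1
    rw [← P.card_mul_index, Nat.cast_mul, inv_mul_cancel_left₀ hPc] at h1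
    exact_mod_cast h1.symm
  obtain ⟨W, hW, hirr, hpW⟩ := exists_irreducible_subRep (subRep R U hU) (p := p)
    (by rwa [hfin])
  obtain ⟨ρ, -, hρ, e, he⟩ := exists_equiv_fin (V := W) (subRep (subRep R U hU) W hW)
  refine ⟨_, ρ, hρ hirr, hpW, ?_⟩
  set σ := subRep (subRep R U hU) W hW with hσ
  have hσ' : ∀ (g : G) (w : W) (h : G), ((σ g w : W) : U).1 h = (w : U).1 (h * g) :=
    fun g w h => rfl
  have := ((isIrreducible_iff _).1 hirr).1
  obtain ⟨w, hw⟩ := exists_ne (0 : W)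
  obtain ⟨g, hg⟩ : ∃ g, (w : U).1 g ≠ 0 := by
    by_contra! h
    exact hw (Subtype.ext (Subtype.ext (funext h)))
  let v : W := weightProj σ ν (σ g w)
  have hv1 : (v : U).1 1 = (w : U).1 g := by
    have h1 : ∀ x : P, ((((ν x⁻¹ : ℂˣ) : ℂ) • σ x (σ g w) : W) : U).1 1 = (w : U).1 g := by
      intro x
      change ((ν x⁻¹ : ℂˣ) : ℂ) * ((σ x (σ g w) : W) : U).1 1 = _
      rw [hσ', hσ', one_mul, (w : U).2 x g, ← mul_assoc, ← Units.val_mul, ← map_mul]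
      simp
    let ev : W →ₗ[ℂ] ℂ := (LinearMap.proj (1 : G)).comp (U.subtype.comp W.subtype)
    change ev (weightProj σ ν (σ g w)) = _
    rw [weightProj_apply]
    have h2 : ∀ x : P, ev (((ν x⁻¹ : ℂˣ) : ℂ) • σ x (σ g w)) = (w : U).1 g := h1
    rw [map_smul, map_sum, Finset.sum_congr rfl fun x _ => h2 x]
    simp
  have hv0 : v ≠ 0 := by
    intro h
    rw [h] at hv1
    exact hg hv1.symm
  refine ⟨e v, fun h => hv0 (by simpa using h), fun x => ?_⟩
  change ρ x (e v) = _
  rw [he, weightProj_mem σ ν (σ g w) x, map_smul]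

end Induced

/-! ### From representations back to sets of characters -/

section Characters

variable {G V : Type*} [Group G] [Finite G] [AddCommGroup V] [Module ℂ V] [FiniteDimensional ℂ V]

theorem character_mem_genChar (ρ : Representation ℂ G V) : ρ.character ∈ genChar G := by
  induction hn : Module.finrank ℂ V using Nat.strong_induction_on generalizing V with
  | _ n ih =>
  subst hn
  by_cases hρ : ρ.IsIrreducible
  · exact AddSubgroup.subset_closure (character_mem_irr hρ)
  by_cases hV : Nontrivial V
  · rw [isIrreducible_iff] at hρ
    push Not at hρ
    obtain ⟨W, hW, hbot, htop⟩ := hρ hV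
    obtain ⟨W', hW', hc⟩ := exists_invariant_isCompl ρ W hW
    have h1 : Module.finrank ℂ W < Module.finrank ℂ V := Submodule.finrank_lt htop
    have h2 : Module.finrank ℂ W' < Module.finrank ℂ V := Submodule.finrank_lt fun h => hbot (by
      simpa [h] using hc.inf_eq_bot)
    have h3 : ρ.character = (subRep ρ W hW).character + (subRep ρ W' hW').character :=
      funext fun g => exists_character_eq_add ρ hW hW' hc g
    rw [h3]
    exact add_mem (ih _ h1 _ rfl) (ih _ h2 _ rfl)
  · rw [not_nontrivial_iff_subsingleton] at hV
    have : ρ.character = 0 := by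
      ext g
      rw [Representation.character, Subsingleton.elim (ρ g) 0, map_zero]
      rfl
    rw [this]
    exact zero_mem _

theorem IsCharacterOrZero.mem_genChar {f : G → ℂ} (hf : IsCharacterOrZero f) : f ∈ genChar G := by
  obtain ⟨n, ρ, rfl⟩ := hf
  exact character_mem_genChar ρ

/-- Removing a linear constituent from a character leaves a character or zero. -/
theorem IsWeightVector.isCharacterOrZero_sub {ρ : Representation ℂ G V} {ν : G →* ℂˣ} {v : V}
    (hv : IsWeightVector ρ ν v) : IsCharacterOrZero (fun g => ρ.character g - ν g) := by
  have hW : ∀ g, ∀ w ∈ ℂ ∙ v, ρ g w ∈ ℂ ∙ v := by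
    intro g w hw
    obtain ⟨c, rfl⟩ := Submodule.mem_span_singleton.1 hw
    rw [map_smul, hv.2]
    exact Submodule.smul_mem _ _ (Submodule.smul_mem _ _ (Submodule.mem_span_singleton_self v))
  obtain ⟨W', hW', hc⟩ := exists_invariant_isCompl ρ _ hW
  have h1 : (fun g => ρ.character g - ν g) = (subRep ρ W' hW').character := by
    ext g
    have hv' : IsWeightVector (subRep ρ _ hW) ν ⟨v, Submodule.mem_span_singleton_self v⟩ :=
      ⟨fun h => hv.1 (congrArg Subtype.val h), fun g => Subtype.ext (hv.2 g)⟩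
    rw [exists_character_eq_add ρ hW hW' hc,
      character_eq_of_isWeightVector (finrank_span_singleton hv.1) hv', add_sub_cancel_left]
  rw [h1]
  exact isCharacterOrZero_character _

theorem exists_rep_of_mem_irrPrime {p : ℕ} {χ : G → ℂ} :
    χ ∈ IrrPrime p G ↔ ∃ (n : ℕ) (ρ : Representation ℂ G (Fin n → ℂ)), ρ.IsIrreducible ∧
      ¬ p ∣ n ∧ χ = ρ.character := by
  constructor
  · rintro ⟨⟨n, ρ, hρ, rfl⟩, d, hd, hp⟩
    refine ⟨n, ρ, hρ, ?_, rfl⟩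
    rw [Representation.char_one, Module.finrank_fin_fun] at hd
    rwa [Nat.cast_inj.1 hd]
  · rintro ⟨n, ρ, hρ, hp, rfl⟩
    exact ⟨⟨n, ρ, hρ, rfl⟩, n, by rw [Representation.char_one, Module.finrank_fin_fun], hp⟩

/-- Whether a linear character of a subgroup occurs in the restriction of a representation only
depends on the character of the representation. -/
theorem exists_isWeightVector_of_character_eq {V' : Type*} [AddCommGroup V'] [Module ℂ V']
    [FiniteDimensional ℂ V'] {ρ : Representation ℂ G V} {ρ' : Representation ℂ G V'}
    (h : ρ.character = ρ'.character) {P : Subgroup G} {ν : P →* ℂˣ} {v : V}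
    (hv : IsWeightVector (ρ.comp P.subtype) ν v) :
    ∃ v', IsWeightVector (ρ'.comp P.subtype) ν v' := by
  have := Fintype.ofFinite P
  have h1 : LinearMap.trace ℂ V (weightProj ρ ν) = LinearMap.trace ℂ V' (weightProj ρ' ν) := by
    simp only [weightProj, map_smul, map_sum]
    congr 1
    exact Finset.sum_congr rfl fun x _ => congrArg _ (congrFun h x)
  have hproj : LinearMap.IsProj (weightSpace ρ ν) (weightProj ρ ν) :=
    ⟨weightProj_mem ρ ν, fun _ => weightProj_of_mem⟩
  by_contra! hno
  have h0 : weightProj ρ' ν = 0 := by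
    ext w
    by_contra hw
    exact hno (weightProj ρ' ν w) ⟨hw, weightProj_mem ρ' ν w⟩
  rw [hproj.trace, h0, map_zero, Nat.cast_eq_zero, Submodule.finrank_eq_zero] at h1
  have h2 : v ∈ weightSpace ρ ν := hv.2
  rw [h1] at h2
  exact hv.1 h2

theorem neg_notMem_irrPrime {p : ℕ} {χ : G → ℂ} (hχ : χ ∈ IrrPrime p G) :
    -χ ∉ IrrPrime p G := by
  rintro ⟨-, d', hd', -⟩
  obtain ⟨-, d, hd, hp⟩ := hχ
  rw [Pi.neg_apply, hd] at hd'
  have h1 : ((d + d' : ℕ) : ℂ) = 0 := by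
    rw [Nat.cast_add, ← hd', add_neg_cancel]
  have h2 : d = 0 := by
    have := Nat.cast_eq_zero.1 h1
    omega
  exact hp (h2 ▸ dvd_zero p)

theorem IsPGroup.mem_irrPrime_iff {p : ℕ} [Fact p.Prime] (hG : IsPGroup p G) {χ : G → ℂ} :
    χ ∈ IrrPrime p G ↔ ∃ ν : G →* ℂˣ, χ = fun g => (ν g : ℂ) := by
  constructor
  · rw [exists_rep_of_mem_irrPrime]
    rintro ⟨n, ρ, hρ, hp, rfl⟩
    obtain ⟨ν, v, hv⟩ := IsPGroup.exists_isWeightVector hG ρ (by rwa [Module.finrank_fin_fun])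
    exact ⟨ν, funext fun g =>
      character_eq_of_isWeightVector (finrank_eq_one_of_isWeightVector hρ hv) hv g⟩
  · rintro ⟨ν, rfl⟩
    exact ⟨linear_mem_irr ν, 1, by simp, fun h => (Fact.out : p.Prime).one_lt.ne'
      (Nat.dvd_one.1 h)⟩

theorem mem_irr_iff_of_comm {A : Type*} [CommGroup A] {χ : A → ℂ} :
    χ ∈ Irr A ↔ ∃ ν : A →* ℂˣ, χ = fun a => (ν a : ℂ) := by
  constructor
  · rintro ⟨n, ρ, hρ, rfl⟩
    have h1 := Representation.IsIrreducible.finrank_eq_one_of_isMulCommutative ρ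
    have := ((isIrreducible_iff ρ).1 hρ).1
    obtain ⟨v, hv⟩ := exists_ne (0 : Fin n → ℂ)
    obtain ⟨ν, hν⟩ := exists_isWeightVector hv fun g =>
      ((finrank_eq_one_iff_of_nonzero' v hv).1 h1 (ρ g v)).imp fun _ h => h.symm
    exact ⟨ν, funext fun g => character_eq_of_isWeightVector h1 hν g⟩
  · rintro ⟨ν, rfl⟩
    exact linear_mem_irr ν

theorem image_irr_abelianization (P : Type*) [Group P] :
    (fun (ψ : Abelianization P → ℂ) (x : P) => ψ (Abelianization.of x)) ''
      Irr (Abelianization P) = Set.range fun (ν : P →* ℂˣ) (x : P) => (ν x : ℂ) := by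
  ext f
  constructor
  · rintro ⟨ψ, hψ, rfl⟩
    obtain ⟨ν, rfl⟩ := mem_irr_iff_of_comm.1 hψ
    exact ⟨ν.comp Abelianization.of, rfl⟩
  · rintro ⟨ν, rfl⟩
    refine ⟨fun a => (Abelianization.lift ν a : ℂ), linear_mem_irr _, ?_⟩
    ext x
    simp

theorem linear_injective {P : Type*} [Group P] :
    Function.Injective fun (ν : P →* ℂˣ) (x : P) => (ν x : ℂ) := fun ν ν' h => by
  ext x
  exact congrFun h x

end Characters

/-! ### The bijection and the passage to (IRC-Syl) -/

section Main

variable {p : ℕ} [Fact p.Prime] {G : Type*} [Group G] [Finite G]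

/-- The canonical bijection between the irreducible characters of degree prime to `p` and the
linear characters of a self-normalizing Sylow `p`-subgroup. -/
theorem IsPSolvable.exists_bijOn (hG : IsPSolvable p G) {P : Subgroup G} (hP : IsPGroup p P)
    (hidx : ¬ p ∣ P.index) (hPN : Subgroup.normalizer (P : Set G) = P) :
    ∃ lam : (G → ℂ) → (P →* ℂˣ),
      (∀ χ ∈ IrrPrime p G, ∃ Δ : P → ℂ, IsCharacterOrZero Δ ∧ Δ ∈ sumsIndNonPicky P ∧
        ∀ x : P, χ x = lam χ x + Δ x) ∧
      Set.BijOn lam (IrrPrime p G) Set.univ := by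
  classical
  obtain ⟨hmain, hinj⟩ := hG.hasUniqueLinearConstituent hP hidx hPN
  have hex : ∀ χ ∈ IrrPrime p G, ∃ (n : ℕ) (ρ : Representation ℂ G (Fin n → ℂ)),
      ρ.IsIrreducible ∧ ¬ p ∣ Module.finrank ℂ (Fin n → ℂ) ∧ χ = ρ.character := by
    intro χ hχ
    obtain ⟨n, ρ, hρ, hp, rfl⟩ := exists_rep_of_mem_irrPrime.1 hχ
    exact ⟨n, ρ, hρ, by rwa [Module.finrank_fin_fun], rfl⟩
  choose! n ρ hρ hp hχ using hex
  have hlam : ∀ χ ∈ IrrPrime p G, HasUniqueLinearConstituent P (ρ χ) := fun χ h =>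
    hmain _ (ρ χ) (hρ χ h) (hp χ h)
  choose! lam hv huniq Δ hΔ hsum using hlam
  refine ⟨lam, fun χ h => ⟨Δ χ, ?_, hΔ χ h, fun x => ?_⟩, fun _ _ => Set.mem_univ _, ?_, ?_⟩
  · obtain ⟨v, hv⟩ := hv χ h
    -- That Δ is a character comes from splitting off a weight line, not from its description as a
    -- sum of induced functions.
    have h1 : Δ χ = fun x => Representation.character
        ((ρ χ).comp P.subtype : Representation ℂ P (Fin (n χ) → ℂ)) x - lam χ x := by
      ext x
      exact eq_sub_of_add_eq' (hsum χ h x).symm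
    rw [h1]
    exact hv.isCharacterOrZero_sub
  · rw [← hsum χ h x, ← hχ χ h]
  · intro χ h χ' h' heq
    obtain ⟨v, hv1⟩ := hv χ h
    obtain ⟨v', hv'⟩ := hv χ' h'
    rw [← heq] at hv'
    rw [hχ χ h, hχ χ' h']
    exact hinj _ _ _ _ (hρ χ h) (hρ χ' h') (hp χ h) (hp χ' h') _ v v' hv1 hv'
  · intro ν _
    obtain ⟨m, σ, hσ, hm, v, hv1⟩ := exists_irreducible_isWeightVector hidx ν
    have h : σ.character ∈ IrrPrime p G := exists_rep_of_mem_irrPrime.2 ⟨m, σ, hσ, hm, rfl⟩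
    refine ⟨_, h, ?_⟩
    -- The representation chosen for this character need not be σ itself, so the occurrence of ν is
    -- transferred through equality of characters.
    obtain ⟨w, hw⟩ := exists_isWeightVector_of_character_eq (hχ _ h) hv1
    exact (huniq _ h ν w hw).symm

/-- Since H = P, every subgroup L of H is a p-group and is its own intersection with P, so the Sylow
condition is automatic; failure of pickiness is exactly membership in S(G, P, H). -/
theorem comp_mem_evI {P : Sylow p G} {Δ : ↥(P : Subgroup G) → ℂ}
    (hPN : Subgroup.normalizer (P : Set G) = (P : Subgroup G))
    (hΔ : Δ ∈ sumsIndNonPicky (P : Subgroup G)) :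
    (fun x => Δ (MulEquiv.subgroupCongr hPN x)) ∈
      evI p ((P : Subgroup G).subgroupOf (Subgroup.normalizer (P : Set G)))
        {Q | Q.map (Subgroup.normalizer (P : Set G)).subtype ∈
          evS (P : Subgroup G) (Subgroup.normalizer (P : Set G))} := by
  unfold sumsIndNonPicky at hΔ
  induction hΔ using AddSubmonoid.closure_induction with
  | zero => exact zero_mem _
  | add f g _ _ hf hg => exact add_mem hf hg
  | mem f hf =>
    obtain ⟨Q, θ, hQ, hθ, rfl⟩ := hf
    let e := MulEquiv.subgroupCongr hPN
    let φ : Subgroup.normalizer (P : Set G) →* (P : Subgroup G) := e.toMonoidHom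
    have hφ : Function.Surjective φ := e.surjective
    have hfun : (fun x => ind Q θ (MulEquiv.subgroupCongr hPN x)) =
        ind (Q.comap φ) (fun q => θ ⟨φ q, q.2⟩) :=
      funext fun x => (ind_comap hφ Q θ x).symm
    have hPtop : (P : Subgroup G).subgroupOf (Subgroup.normalizer (P : Set G)) = ⊤ := by
      rw [Subgroup.subgroupOf_eq_top, hPN]
    rw [hPtop, hfun]
    refine AddSubgroup.subset_closure ⟨Q.comap φ, _, ?_, ?_, ?_, rfl⟩
    · exact (hθ.comp ((φ.comp (Q.comap φ).subtype).codRestrict Q fun q => q.2)).mem_genChar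
    · rw [Subgroup.top_subgroupOf]
      have h1 : IsPGroup p (⊤ : Subgroup (Q.comap φ)) :=
        (((P.2.of_equiv e.symm).to_subgroup _).to_subgroup _)
      exact ⟨h1.toSylow (by
        rw [Subgroup.index_top]
        exact fun h => (Fact.out : p.Prime).one_lt.ne' (Nat.dvd_one.1 h)), rfl⟩
    · rw [inf_top_eq, Set.mem_ofPred_eq]
      unfold IsPicky at hQ
      push Not at hQ
      obtain ⟨g, hg, hne⟩ := hQ
      have hmap : (Q.comap φ).map (Subgroup.normalizer (P : Set G)).subtype =
          Q.map (P : Subgroup G).subtype := by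
        ext x
        constructor
        · rintro ⟨y, hy, rfl⟩
          exact ⟨e y, hy, rfl⟩
        · rintro ⟨y, hy, rfl⟩
          refine ⟨e.symm y, ?_, rfl⟩
          change e (e.symm y) ∈ Q
          rwa [e.apply_symm_apply]
      rw [hmap]
      exact ⟨Subgroup.map_subtype_le Q, g, fun h => hne (conjBy_eq_iff.2 h), hg⟩

end Main

end EvseevPicky

theorem theorem5p3 {G : Type*} [Group G] [Finite G] (p : ℕ) [Fact p.Prime]
    (hG : EvseevPicky.IsPSolvable p G) (P : Sylow p G)
    (hP : Subgroup.normalizer (P : Set G) = (P : Subgroup G)) :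
    (∃ lam : (G → ℂ) → (↥(P : Subgroup G) → ℂ),
      (∀ χ ∈ EvseevPicky.IrrPrime p G,
        lam χ ∈ EvseevPicky.Irr ↥(P : Subgroup G) ∧ lam χ 1 = 1 ∧
        ∃ Δ : ↥(P : Subgroup G) → ℂ,
          EvseevPicky.IsCharacterOrZero Δ ∧
          Δ ∈ EvseevPicky.sumsIndNonPicky (P : Subgroup G) ∧
          EvseevPicky.res (P : Subgroup G) χ = lam χ + Δ) ∧
      -- the irreducible characters of `P / P'`, inflated to `P`
      Set.BijOn lam (EvseevPicky.IrrPrime p G)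
        ((fun (ψ : Abelianization ↥(P : Subgroup G) → ℂ) (x : ↥(P : Subgroup G)) =>
            ψ (Abelianization.of x)) ''
          EvseevPicky.Irr (Abelianization ↥(P : Subgroup G)))) ∧
    EvseevPicky.IRCSyl p P := by
  classical
  obtain ⟨lam, hlam, hbij⟩ := hG.exists_bijOn P.2 P.not_dvd_index hP
  constructor
  · refine ⟨fun χ x => lam χ x, fun χ hχ => ⟨EvseevPicky.linear_mem_irr _, by simp, ?_⟩, ?_⟩
    · obtain ⟨Δ, h1, h2, h3⟩ := hlam χ hχ
      exact ⟨Δ, h1, h2, funext h3⟩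
    · rw [EvseevPicky.image_irr_abelianization, ← Set.image_univ]
      exact (EvseevPicky.linear_injective.injOn.bijOn_image).comp hbij
  · let e := MulEquiv.subgroupCongr hP
    have hH : IsPGroup p (Subgroup.normalizer (P : Set G)) := P.2.of_equiv e.symm
    -- Odd extension of the bijection to signed characters; values outside ±Irr_{p'}(G) play no
    -- role.
    let F : (G → ℂ) → (Subgroup.normalizer (P : Set G) → ℂ) := fun f =>
      if f ∈ EvseevPicky.IrrPrime p G then fun h => (lam f (e h) : ℂ)
      else fun h => -(lam (-f) (e h) : ℂ)
    have hFpos : ∀ f ∈ EvseevPicky.IrrPrime p G, F f = fun h => (lam f (e h) : ℂ) :=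
      fun f hf => if_pos hf
    have hFneg : ∀ f ∈ EvseevPicky.IrrPrime p G, F (-f) = -F f := by
      intro f hf
      rw [hFpos f hf]
      refine (if_neg (EvseevPicky.neg_notMem_irrPrime hf)).trans ?_
      rw [neg_neg]
      rfl
    have hFmem : ∀ f ∈ EvseevPicky.IrrPrime p G,
        F f ∈ EvseevPicky.IrrPrime p (Subgroup.normalizer (P : Set G)) := by
      intro f hf
      rw [EvseevPicky.IsPGroup.mem_irrPrime_iff hH]
      exact ⟨(lam f).comp e.toMonoidHom, hFpos f hf⟩
    have hFinj : ∀ f ∈ EvseevPicky.IrrPrime p G, ∀ f' ∈ EvseevPicky.IrrPrime p G,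
        F f = F f' → f = f' := by
      intro f hf f' hf' heq
      rw [hFpos f hf, hFpos f' hf'] at heq
      refine hbij.injOn hf hf' (EvseevPicky.linear_injective (funext fun x => ?_))
      simpa using congrFun heq (e.symm x)
    have hFsurj : ∀ ψ ∈ EvseevPicky.IrrPrime p (Subgroup.normalizer (P : Set G)),
        ∃ f ∈ EvseevPicky.IrrPrime p G, F f = ψ := by
      intro ψ hψ
      obtain ⟨ν, rfl⟩ := (EvseevPicky.IsPGroup.mem_irrPrime_iff hH).1 hψ
      obtain ⟨f, hf, hfν⟩ := hbij.surjOn (Set.mem_univ (ν.comp e.symm.toMonoidHom))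
      refine ⟨f, hf, ?_⟩
      rw [hFpos f hf, hfν]
      ext h
      simp
    have hFdiff : ∀ f ∈ EvseevPicky.IrrPrime p G,
        F f - EvseevPicky.res (Subgroup.normalizer (P : Set G)) f ∈
          EvseevPicky.evI p ((P : Subgroup G).subgroupOf (Subgroup.normalizer (P : Set G)))
            {Q | Q.map (Subgroup.normalizer (P : Set G)).subtype ∈
              EvseevPicky.evS (P : Subgroup G) (Subgroup.normalizer (P : Set G))} := by
      intro f hf
      obtain ⟨Δ, -, h2, h3⟩ := hlam f hf
      have h4 : F f - EvseevPicky.res (Subgroup.normalizer (P : Set G)) f =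
          -(fun x => Δ (e x)) := by
        ext h
        have h5 := h3 (e h)
        change f h = _ at h5
        rw [hFpos f hf, Pi.sub_apply, Pi.neg_apply]
        change _ - f h = _
        rw [h5]
        ring
      rw [h4]
      exact neg_mem (EvseevPicky.comp_mem_evI hP h2)
    refine ⟨F, ⟨?_, ?_, ?_⟩, ?_⟩
    · rintro f (hf | hf)
      · exact Or.inl (hFmem f hf)
      · refine Or.inr ?_
        have h1 := hFneg _ hf
        rw [neg_neg] at h1
        rw [h1, neg_neg]
        exact hFmem _ hf
    -- Signs cannot be confused: an irreducible character of p'-degree and its negative are never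
    -- both in Irr_{p'}(H).
    · have hsign : ∀ f ∈ EvseevPicky.IrrPrime p G, ∀ f' ∈ EvseevPicky.IrrPrime p G,
          F f ≠ -F f' := fun f hf f' hf' h =>
        EvseevPicky.neg_notMem_irrPrime (hFmem f' hf') (h ▸ hFmem f hf)
      rintro f (hf | hf) f' (hf' | hf') heq
      · exact hFinj f hf f' hf' heq
      · rw [← neg_neg f', hFneg _ hf'] at heq
        exact absurd heq (hsign _ hf _ hf')
      · rw [← neg_neg f, hFneg _ hf] at heq
        exact absurd heq.symm (hsign _ hf' _ hf)
      · rw [← neg_neg f, ← neg_neg f', hFneg _ hf, hFneg _ hf', neg_inj] at heq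
        exact neg_injective (hFinj _ hf _ hf' heq)
    · rintro ψ (hψ | hψ)
      · obtain ⟨f, hf, h⟩ := hFsurj ψ hψ
        exact ⟨f, Or.inl hf, h⟩
      · obtain ⟨f, hf, h⟩ := hFsurj _ hψ
        refine ⟨-f, Or.inr (by rwa [neg_neg]), ?_⟩
        rw [hFneg f hf, h, neg_neg]
    · rintro f (hf | hf)
      · exact ⟨hFneg f hf, hFdiff f hf⟩
      · have h1 := hFneg _ hf
        rw [neg_neg] at h1
        refine ⟨by rw [h1, neg_neg], ?_⟩
        have h2 := neg_mem (hFdiff _ hf)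
        have h3 : F f - EvseevPicky.res (Subgroup.normalizer (P : Set G)) f =
            -(F (-f) - EvseevPicky.res (Subgroup.normalizer (P : Set G)) (-f)) := by
          rw [h1]
          ext h
          simp [EvseevPicky.res]
          ring
        rw [h3]
        exact h2
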